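/- Let $H=\{w=w_1+\mathrm{i}w_2\in\mathbb{C} : w_2>0\}$ be the upper half plane and let $n\ge 2$ be an integer. All manifolds, metrics and maps are smooth. For a K\"ahler manifold $(K,k,J^K)$ of complex dimension $n-1$, equip $H\times K$ with the product complex structure and with the warped product metric $$ g=\mathrm{d}w\otimes\mathrm{d}\overline{w}+w_2^{\frac{2}{n-1}}\,k, \qquad \mathrm{d}w\otimes\mathrm{d}\overline{w}=\mathrm{d}w_1^2+\mathrm{d}w_2^2 . $$ (1) For every K\"ahler manifold $K$ of complex dimension $n-1$, every holomorphic map $\varphi$ from $(H\times K,g)$ into a $(1,2)$-symplectic almost Hermitian manifold $(N,h,J^N)$ is biharmonic. (2) This gives examples in all complex dimensions $n\ge 2$: for a suitable K\"ahler structure on $K=\mathbb{C}^{n-1}$ there are an almost Hermitian structure on $\mathbb{C}$ that is $(1,2)$-symplectic and a holomorphic map from $(H\times K,g)$ into it that is biharmonic but not harmonic. Here a map $\varphi$ between almost Hermitian manifolds is holomorphic if $\mathrm{d}\varphi\circ J=J^N\circ\mathrm{d}\varphi$; an almost Hermitian manifold is $(1,2)$-symplectic if the $(1,2)$-part of $\mathrm{d}\Omega$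 vanishes, where $\Omega(X,Y)=h(X,J^NY)$; $\varphi$ is harmonic if its tension field $\tau(\varphi)=\operatorname{trace}\nabla\mathrm{d}\varphi$ vanishes, and biharmonic if its bitension field $$\tau_2(\varphi)=\sum_i\Big(\nabla^{\varphi}_{e_i}\nabla^{\varphi}_{e_i}\tau(\varphi)-\nabla^{\varphi}_{\nabla_{e_i}e_i}\tau(\varphi)+R^N\big(\tau(\varphi),\mathrm{d}\varphi(e_i)\big)\mathrm{d}\varphi(e_i)\Big)$$ vanishes, where $\{e_i\}$ is a local orthonormal frame of $(H\times K,g)$, $\nabla^\varphi$ is the connection induced on $\varphi^{-1}TN$ by the Levi-Civita connection of $h$, and $R^N(X,Y)Z=\nabla_X\nabla_YZ-\nabla_Y\nabla_XZ-\nabla_{[X,Y]}Z$. -/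

import Mathlib

open scoped Manifold ContDiff Bundle
open Bundle

noncomputable section

/-! ### Riemannian and almost Hermitian geometry on open subsets of a vector space -/

section Coordinates

variable {E : Type*} [NormedAddCommGroup E] [NormedSpace ℝ E]
  {F : Type*} [NormedAddCommGroup F] [NormedSpace ℝ F]

/-- The trace of a bilinear map `B` with respect to a scalar product `G`, that is
`∑ i, B (b i) (b^i) = ∑ i j, G^{ij} B (b i) (b j)` for a basis `b i` of `E`, where
`b^i = ∑ j, G^{ij} b j` represents the `i`-th coordinate form with respect to `G`.
It equals `∑ i, B (e i) (e i)` for every `G`-orthonormal basis `e i`. -/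
def metricTrace [FiniteDimensional ℝ E] (G : E →L[ℝ] E →L[ℝ] ℝ) (B : E → E → F) : F :=
  ∑ i, B (Module.finBasis ℝ E i)
    (G.inverse (LinearMap.toContinuousLinearMap ((Module.finBasis ℝ E).coord i)))

/-- The Christoffel symbol `Γ(u, v) = ∇_u v` (for constant `u` and `v`) of the Levi-Civita connection
of the metric `G`, given by Koszul's formula
`G(Γ(u, v), w) = (∂_u G(v, w) + ∂_v G(u, w) - ∂_w G(u, v)) / 2`. -/
def christoffel (G : E → E →L[ℝ] E →L[ℝ] ℝ) (x u v : E) : E :=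
  (G x).inverse ((1 / 2 : ℝ) •
    (fderiv ℝ G x u v + fderiv ℝ G x v u - ((fderiv ℝ G x).flip u).flip v))

/-- The curvature `R(u, v) z = ∇_u ∇_v z - ∇_v ∇_u z` (for constant `u`, `v`, `z`). -/
def curvature (G : E → E →L[ℝ] E →L[ℝ] ℝ) (x u v z : E) : E :=
  fderiv ℝ (fun y => christoffel G y v z) x u - fderiv ℝ (fun y => christoffel G y u z) x v
    + christoffel G x u (christoffel G x v z) - christoffel G x v (christoffel G x u z)

/-- The derivative `∇^φ_u V` of a section `V` of the pull-back by `φ` of the tangent bundle of the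
target, for the connection induced by the Levi-Civita connection of the metric `h`. -/
def pullbackDeriv (h : F → F →L[ℝ] F →L[ℝ] ℝ) (φ V : E → F) (x u : E) : F :=
  fderiv ℝ V x u + christoffel h (φ x) (fderiv ℝ φ x u) (V x)

/-- The second fundamental form `∇dφ(u, v) = ∇^φ_u (dφ v) - dφ (∇_u v)`. -/
def secondFundamentalForm (g : E → E →L[ℝ] E →L[ℝ] ℝ) (h : F → F →L[ℝ] F →L[ℝ] ℝ) (φ : E → F)
    (x u v : E) : F :=
  pullbackDeriv h φ (fun y => fderiv ℝ φ y v) x u - fderiv ℝ φ x (christoffel g x u v)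

/-- The tension field `τ(φ) = tr ∇dφ`. -/
def tension [FiniteDimensional ℝ E] (g : E → E →L[ℝ] E →L[ℝ] ℝ) (h : F → F →L[ℝ] F →L[ℝ] ℝ)
    (φ : E → F) (x : E) : F :=
  metricTrace (g x) (secondFundamentalForm g h φ x)

/-- The second covariant derivative `∇^φ_u ∇^φ_v V - ∇^φ_{∇_u v} V` of a section `V` of the pull-back
by `φ` of the tangent bundle of the target (for constant `u` and `v`). -/
def pullbackDeriv₂ (g : E → E →L[ℝ] E →L[ℝ] ℝ) (h : F → F →L[ℝ] F →L[ℝ] ℝ) (φ V : E → F)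
    (x u v : E) : F :=
  pullbackDeriv h φ (fun y => pullbackDeriv h φ V y v) x u
    - pullbackDeriv h φ V x (christoffel g x u v)

/-- The bitension field `τ₂(φ) = (tr (∇^φ)² + Ric^φ) τ(φ)`, where
`Ric^φ V = tr (R(V, dφ ·) dφ ·)`. -/
def bitension [FiniteDimensional ℝ E] (g : E → E →L[ℝ] E →L[ℝ] ℝ) (h : F → F →L[ℝ] F →L[ℝ] ℝ)
    (φ : E → F) (x : E) : F :=
  metricTrace (g x) (pullbackDeriv₂ g h φ (tension g h φ) x)
    + metricTrace (g x) (fun u v =>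
        curvature h (φ x) (tension g h φ x) (fderiv ℝ φ x u) (fderiv ℝ φ x v))

/-- The Nijenhuis tensor `N(X, Y) = [JX, JY] - J[JX, Y] - J[X, JY] - [X, Y]`. -/
def nijenhuis (J : E → E →L[ℝ] E) (X Y : E → E) (x : E) : E :=
  VectorField.lieBracket ℝ (fun y => J y (X y)) (fun y => J y (Y y)) x
    - J x (VectorField.lieBracket ℝ (fun y => J y (X y)) Y x)
    - J x (VectorField.lieBracket ℝ X (fun y => J y (Y y)) x)
    - VectorField.lieBracket ℝ X Y x

/-- The value `Ω(u, v) = G(u, Jv)` of the fundamental two-form. -/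
def fundamentalForm (G : E → E →L[ℝ] E →L[ℝ] ℝ) (J : E → E →L[ℝ] E) (x u v : E) : ℝ :=
  G x u (J x v)

/-- The exterior derivative `dΩ(u, v, w)` of the fundamental two-form (for constant `u`, `v`, `w`). -/
def dFundamentalForm (G : E → E →L[ℝ] E →L[ℝ] ℝ) (J : E → E →L[ℝ] E) (x u v w : E) : ℝ :=
  fderiv ℝ (fun y => fundamentalForm G J y v w) x u
    + fderiv ℝ (fun y => fundamentalForm G J y w u) x v
    + fderiv ℝ (fun y => fundamentalForm G J y u v) x w

/-- The value of the complex trilinear extension of a real trilinear form `a` at the complex vectors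
`u.1 + i u.2`, `v.1 + i v.2`, `w.1 + i w.2`. -/
def complexExtension (a : E → E → E → ℝ) (u v w : E × E) : ℂ :=
  ((a u.1 v.1 w.1 - a u.2 v.2 w.1 - a u.2 v.1 w.2 - a u.1 v.2 w.2 : ℝ) : ℂ)
    + ((a u.2 v.1 w.1 + a u.1 v.2 w.1 + a u.1 v.1 w.2 - a u.2 v.2 w.2 : ℝ) : ℂ) * Complex.I

end Coordinates

/-! ### Almost Hermitian manifolds and maps between them -/

section Manifolds

variable {E : Type*} [NormedAddCommGroup E] [NormedSpace ℝ E]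
  {H : Type*} [TopologicalSpace H] {I : ModelWithCorners ℝ E H}
  {M : Type*} [TopologicalSpace M] [ChartedSpace H M] [IsManifold I ∞ M]
  {F : Type*} [NormedAddCommGroup F] [NormedSpace ℝ F]
  {H' : Type*} [TopologicalSpace H'] {I' : ModelWithCorners ℝ F H'}
  {N : Type*} [TopologicalSpace N] [ChartedSpace H' N] [IsManifold I' ∞ N]

variable (I M) in
/-- An almost Hermitian structure on a smooth manifold `M`: a smooth Riemannian metric and a smooth
orthogonal almost complex structure `J`. -/
structure AlmostHermitianStructure where
  metric : ContMDiffRiemannianMetric I ∞ E (fun x : M => TangentSpace I x)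
  J : ∀ x : M, TangentSpace I x →L[ℝ] TangentSpace I x
  contMDiff_J : ContMDiff I (I.prod 𝓘(ℝ, E →L[ℝ] E)) ∞
    (fun x : M => TotalSpace.mk' (E →L[ℝ] E)
      (E := fun x : M => TangentSpace I x →L[ℝ] TangentSpace I x) x (J x))
  J_J : ∀ x v, J x (J x v) = -v
  inner_J_J : ∀ x v w, metric.inner x (J x v) (J x w) = metric.inner x v w

/-- The metric, read in the chart `e`. -/
def coordMetric (g : ContMDiffRiemannianMetric I ∞ E (fun x : M => TangentSpace I x))
    (e : OpenPartialHomeomorph M H) (x : E) : E →L[ℝ] E →L[ℝ] ℝ :=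
  ContinuousLinearMap.bilinearComp (E := E) (F := E) (g.inner ((e.extend I).symm x))
    (mfderiv 𝓘(ℝ, E) I (e.extend I).symm x) (mfderiv 𝓘(ℝ, E) I (e.extend I).symm x)

/-- The almost complex structure, read in the chart `e`. -/
def coordJ (S : AlmostHermitianStructure I M) (e : OpenPartialHomeomorph M H) (x : E) :
    E →L[ℝ] E :=
  (mfderiv I 𝓘(ℝ, E) (e.extend I) ((e.extend I).symm x)).comp
    ((S.J ((e.extend I).symm x)).comp (mfderiv 𝓘(ℝ, E) I (e.extend I).symm x))

variable (I I') in
/-- The map `φ`, read in the charts `e` and `e'`. -/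
def coordMap (φ : M → N) (e : OpenPartialHomeomorph M H) (e' : OpenPartialHomeomorph N H') :
    E → F :=
  fun x => e'.extend I' (φ ((e.extend I).symm x))

/-- Kähler: the Nijenhuis tensor of `J` vanishes (`J` is integrable) and the fundamental two-form is
closed. -/
def AlmostHermitianStructure.IsKahler (S : AlmostHermitianStructure I M) : Prop :=
  ∀ e ∈ atlas H M, ∀ x ∈ (e.extend I).target,
    (∀ u v : E, nijenhuis (coordJ S e) (fun _ => u) (fun _ => v) x = 0) ∧
      ∀ u v w : E, dFundamentalForm (coordMetric S.metric e) (coordJ S e) x u v w = 0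

/-- `(1,2)`-symplectic: the `(1,2)`-part of `dΩ` vanishes, i.e. (the complex extension of) `dΩ` is
zero on `T' × T'' × T''`, where `T' = {u - i J u}` and `T'' = {u + i J u}`. -/
def AlmostHermitianStructure.IsOneTwoSymplectic (S : AlmostHermitianStructure I M) : Prop :=
  ∀ e ∈ atlas H M, ∀ x ∈ (e.extend I).target, ∀ u v w : E,
    complexExtension (dFundamentalForm (coordMetric S.metric e) (coordJ S e) x)
      (u, -coordJ S e x u) (v, coordJ S e x v) (w, coordJ S e x w) = 0

/-- A (pseudo-)holomorphic map between almost Hermitian manifolds: `dφ ∘ J = J ∘ dφ`. -/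
def IsHolomorphicMap (S : AlmostHermitianStructure I M) (T : AlmostHermitianStructure I' N)
    (φ : M → N) : Prop :=
  ContMDiff I I' ∞ φ ∧
    ∀ x (v : TangentSpace I x), mfderiv I I' φ x (S.J x v) = T.J (φ x) (mfderiv I I' φ x v)

/-- A smooth map is harmonic if its tension field (computed in charts) vanishes. -/
def IsHarmonicMap [FiniteDimensional ℝ E]
    (g : ContMDiffRiemannianMetric I ∞ E (fun x : M => TangentSpace I x))
    (h : ContMDiffRiemannianMetric I' ∞ F (fun y : N => TangentSpace I' y)) (φ : M → N) : Prop :=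
  ContMDiff I I' ∞ φ ∧ ∀ e ∈ atlas H M, ∀ e' ∈ atlas H' N, ∀ p ∈ e.source, φ p ∈ e'.source →
    tension (coordMetric g e) (coordMetric h e') (coordMap I I' φ e e') (e.extend I p) = 0

/-- A smooth map is biharmonic if its bitension field (computed in charts) vanishes. -/
def IsBiharmonicMap [FiniteDimensional ℝ E]
    (g : ContMDiffRiemannianMetric I ∞ E (fun x : M => TangentSpace I x))
    (h : ContMDiffRiemannianMetric I' ∞ F (fun y : N => TangentSpace I' y)) (φ : M → N) : Prop :=
  ContMDiff I I' ∞ φ ∧ ∀ e ∈ atlas H M, ∀ e' ∈ atlas H' N, ∀ p ∈ e.source, φ p ∈ e'.source →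
    bitension (coordMetric g e) (coordMetric h e') (coordMap I I' φ e e') (e.extend I p) = 0

end Manifolds

/-! ### Warped products

The helper facts show that the metric and the almost complex structure below are smooth. -/

set_option synthInstance.maxHeartbeats 400000
set_option maxHeartbeats 1000000

section WarpedProduct

variable {E : Type*} [NormedAddCommGroup E] [NormedSpace ℝ E]
  {H : Type*} [TopologicalSpace H] {I : ModelWithCorners ℝ E H}
  {M : Type*} [TopologicalSpace M] [ChartedSpace H M]
  {E' : Type*} [NormedAddCommGroup E'] [NormedSpace ℝ E']
  {H' : Type*} [TopologicalSpace H'] {I' : ModelWithCorners ℝ E' H'}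
  {M' : Type*} [TopologicalSpace M'] [ChartedSpace H' M']

theorem tangentCoordChange_prod [IsManifold I 1 M] [IsManifold I' 1 M'] (x y z : M × M')
    (hx : z ∈ (chartAt (ModelProd H H') x).source) (hy : z ∈ (chartAt (ModelProd H H') y).source) :
    tangentCoordChange (I.prod I') x y z =
      (tangentCoordChange I x.1 y.1 z.1).prodMap (tangentCoordChange I' x.2 y.2 z.2) := by
  have hz : z ∈ (extChartAt (I.prod I') x).source ∩ (extChartAt (I.prod I') y).source := by
    simpa [extChartAt_source] using ⟨hx, hy⟩
  have h := hasFDerivWithinAt_tangentCoordChange hz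
  simp only [extChartAt_prod, PartialEquiv.prod_source, Set.mem_inter_iff, Set.mem_prod] at hz
  have h1 := hasFDerivWithinAt_tangentCoordChange (I := I) (show z.1 ∈ (extChartAt I x.1).source ∩ (extChartAt I y.1).source from ⟨hz.1.1, hz.2.1⟩)
  have h2 := hasFDerivWithinAt_tangentCoordChange (I := I') (show z.2 ∈ (extChartAt I' x.2).source ∩ (extChartAt I' y.2).source from ⟨hz.1.2, hz.2.2⟩)
  have hr : Set.range (I.prod I') = Set.range I ×ˢ Set.range I' := ModelWithCorners.range_prod
  rw [hr] at h
  have h3 := HasFDerivWithinAt.prodMap (p := extChartAt (I.prod I') x z)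
    (s := Set.range I ×ˢ Set.range I') (h1.mono (Set.fst_image_prod_subset _ _))
    (h2.mono (Set.snd_image_prod_subset _ _))
  refine UniqueDiffWithinAt.eq ?_ h ?_
  · rw [← hr]; exact (I.prod I').uniqueDiffOn _ ⟨chartAt (ModelProd H H') x z, rfl⟩
  · simpa [extChartAt_prod] using! h3

theorem contMDiffAt_bilin_iff [IsManifold I 1 M]
    (g : ∀ x : M, TangentSpace I x →L[ℝ] TangentSpace I x →L[ℝ] ℝ) (x₀ : M) :
    ContMDiffAt I (I.prod 𝓘(ℝ, E →L[ℝ] E →L[ℝ] ℝ)) ∞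
      (fun x : M => TotalSpace.mk' (E →L[ℝ] E →L[ℝ] ℝ)
        (E := fun x : M => TangentSpace I x →L[ℝ] TangentSpace I x →L[ℝ] ℝ) x (g x)) x₀ ↔
    ContMDiffAt I 𝓘(ℝ, E →L[ℝ] E →L[ℝ] ℝ) ∞ (fun x : M =>
      ContinuousLinearMap.bilinearComp (E := E) (F := E) (g x)
        (tangentCoordChange I x₀ x x) (tangentCoordChange I x₀ x x)) x₀ := by
  rw [contMDiffAt_section]
  refine Filter.EventuallyEq.contMDiffAt_iff ?_
  filter_upwards [chart_source_mem_nhds H x₀] with x hx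
  rw [hom_trivializationAt_apply]
  have hb : x ∈ (trivializationAt E (TangentSpace I) x₀).baseSet := by simpa using hx
  ext v w
  rw [inCoordinates_apply_eq₂ hb hb (Set.mem_univ _)]
  have h := TangentBundle.symmL_trivializationAt_eq_core (I := I) hx
  rw [← Trivialization.symmL_apply _ (R := ℝ) hb, ← Trivialization.symmL_apply _ (R := ℝ) hb, h]
  have ht : ∀ t : ℝ, (Trivialization.linearMapAt ℝ
      (trivializationAt ℝ (fun _ : M => ℝ) x₀) x) t = t := fun t => by simp
  exact ht _

theorem contMDiffAt_endo_iff [IsManifold I 1 M]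
    (J : ∀ x : M, TangentSpace I x →L[ℝ] TangentSpace I x) (x₀ : M) :
    ContMDiffAt I (I.prod 𝓘(ℝ, E →L[ℝ] E)) ∞
      (fun x : M => TotalSpace.mk' (E →L[ℝ] E)
        (E := fun x : M => TangentSpace I x →L[ℝ] TangentSpace I x) x (J x)) x₀ ↔
    ContMDiffAt I 𝓘(ℝ, E →L[ℝ] E) ∞ (fun x : M =>
      (tangentCoordChange I x x₀ x).comp (ContinuousLinearMap.comp (M₂ := E) (J x : E →L[ℝ] E)
        (tangentCoordChange I x₀ x x))) x₀ := by
  rw [contMDiffAt_section]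
  refine Filter.EventuallyEq.contMDiffAt_iff ?_
  filter_upwards [chart_source_mem_nhds H x₀] with x hx
  rw [hom_trivializationAt_apply]
  have hb : x ∈ (trivializationAt E (TangentSpace I) x₀).baseSet := by simpa using hx
  dsimp only [ContinuousLinearMap.inCoordinates, TotalSpace.mk']
  rw [TangentBundle.symmL_trivializationAt_eq_core (I := I) hx,
    TangentBundle.continuousLinearMapAt_trivializationAt_eq_core (I := I) hx]
  rfl

/-- The bilinear form `g₁ + c • g₂` on a product of tangent spaces. -/
def prodBilin {V W : Type*} [NormedAddCommGroup V] [NormedSpace ℝ V] [NormedAddCommGroup W]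
    [NormedSpace ℝ W] (g₁ : V →L[ℝ] V →L[ℝ] ℝ) (c : ℝ) (g₂ : W →L[ℝ] W →L[ℝ] ℝ) :
    V × W →L[ℝ] V × W →L[ℝ] ℝ :=
  g₁.bilinearComp (ContinuousLinearMap.fst ℝ V W) (ContinuousLinearMap.fst ℝ V W)
    + c • g₂.bilinearComp (ContinuousLinearMap.snd ℝ V W) (ContinuousLinearMap.snd ℝ V W)

theorem contDiff_bilinearComp {X Y : Type*} [NormedAddCommGroup X] [NormedSpace ℝ X]
    [NormedAddCommGroup Y] [NormedSpace ℝ Y] (A : X →L[ℝ] Y) :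
    ContDiff ℝ ∞ (fun B : Y →L[ℝ] Y →L[ℝ] ℝ => B.bilinearComp A A) := by
  have h1 : ContDiff ℝ ∞ (fun B : Y →L[ℝ] Y →L[ℝ] ℝ =>
      ((ContinuousLinearMap.compL ℝ X Y ℝ).flip A).comp (B.comp A)) :=
    contDiff_const.clm_comp (contDiff_id.clm_comp contDiff_const)
  exact h1

theorem contDiff_prodBilin {V W : Type*} [NormedAddCommGroup V] [NormedSpace ℝ V]
    [NormedAddCommGroup W] [NormedSpace ℝ W] :
    ContDiff ℝ ∞ (fun t : (V →L[ℝ] V →L[ℝ] ℝ) × ℝ × (W →L[ℝ] W →L[ℝ] ℝ) =>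
      prodBilin t.1 t.2.1 t.2.2) := by
  have h₁ : ContDiff ℝ ∞ (fun t : (V →L[ℝ] V →L[ℝ] ℝ) × ℝ × (W →L[ℝ] W →L[ℝ] ℝ) =>
      t.1.bilinearComp (ContinuousLinearMap.fst ℝ V W) (ContinuousLinearMap.fst ℝ V W)) :=
    (contDiff_bilinearComp _).comp contDiff_fst
  have h₃ : ContDiff ℝ ∞ (fun t : (V →L[ℝ] V →L[ℝ] ℝ) × ℝ × (W →L[ℝ] W →L[ℝ] ℝ) => t.2.1) :=
    contDiff_fst.comp contDiff_snd
  have h₄ : ContDiff ℝ ∞ (fun t : (V →L[ℝ] V →L[ℝ] ℝ) × ℝ × (W →L[ℝ] W →L[ℝ] ℝ) =>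
      t.2.1 • ContinuousLinearMap.snd ℝ V W) := h₃.smul contDiff_const
  have h₂ : ContDiff ℝ ∞ (fun t : (V →L[ℝ] V →L[ℝ] ℝ) × ℝ × (W →L[ℝ] W →L[ℝ] ℝ) =>
      ((ContinuousLinearMap.compL ℝ (V × W) W ℝ).flip (ContinuousLinearMap.snd ℝ V W)).comp
        (t.2.2.comp (t.2.1 • ContinuousLinearMap.snd ℝ V W))) :=
    contDiff_const.clm_comp ((contDiff_snd.comp contDiff_snd).clm_comp h₄)
  convert! h₁.add h₂ using 2 with t
  refine ContinuousLinearMap.ext fun v => ContinuousLinearMap.ext fun w => ?_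
  simp [prodBilin]

section
variable {V W : Type*} [NormedAddCommGroup V] [NormedSpace ℝ V]
    [NormedAddCommGroup W] [NormedSpace ℝ W] (g₁ : V →L[ℝ] V →L[ℝ] ℝ) (c : ℝ)
    (g₂ : W →L[ℝ] W →L[ℝ] ℝ)

theorem prodBilin_apply (v w : V × W) :
    prodBilin g₁ c g₂ v w = g₁ v.1 w.1 + c * g₂ v.2 w.2 := rfl

theorem nonneg_of_pos (h₁ : ∀ v, v ≠ 0 → 0 < g₁ v v) (v : V) : 0 ≤ g₁ v v := by
  by_cases h : v = 0
  · simp [h]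
  · exact (h₁ v h).le

theorem prodBilin_symm (h₁ : ∀ v w, g₁ v w = g₁ w v) (h₂ : ∀ v w, g₂ v w = g₂ w v)
    (v w : V × W) : prodBilin g₁ c g₂ v w = prodBilin g₁ c g₂ w v := by
  rw [prodBilin_apply, prodBilin_apply, h₁, h₂]

theorem prodBilin_pos (h₁ : ∀ v, v ≠ 0 → 0 < g₁ v v) (hc : 0 < c) (h₂ : ∀ v, v ≠ 0 → 0 < g₂ v v)
    (v : V × W) (hv : v ≠ 0) : 0 < prodBilin g₁ c g₂ v v := by
  rw [prodBilin_apply]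
  by_cases h : v.2 = 0
  · have h' : v.1 ≠ 0 := fun h' => hv (Prod.ext h' h)
    simpa [h] using h₁ _ h'
  · exact add_pos_of_nonneg_of_pos (nonneg_of_pos g₁ h₁ _) (mul_pos hc (h₂ _ h))

theorem prodBilin_bounded (h₁ : ∀ v, v ≠ 0 → 0 < g₁ v v) (hc : 0 < c)
    (h₂ : ∀ v, v ≠ 0 → 0 < g₂ v v) (hb₁ : Bornology.IsVonNBounded ℝ {v | g₁ v v < 1})
    (hb₂ : Bornology.IsVonNBounded ℝ {v | g₂ v v < 1}) :
    Bornology.IsVonNBounded ℝ {v : V × W | prodBilin g₁ c g₂ v v < 1} := by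
  rw [NormedSpace.isVonNBounded_iff] at *
  obtain ⟨A, hA⟩ := hb₁.exists_norm_le
  obtain ⟨B, hB⟩ := hb₂.exists_norm_le
  have hs : 0 < √c := Real.sqrt_pos.2 hc
  refine isBounded_iff_forall_norm_le.2 ⟨max A (B / √c), fun v hv => ?_⟩
  have hv' : g₁ v.1 v.1 + c * g₂ v.2 v.2 < 1 := hv
  have n1 := nonneg_of_pos g₁ h₁ v.1
  have n2 := mul_nonneg hc.le (nonneg_of_pos g₂ h₂ v.2)
  refine max_le_max (hA _ ?_) ?_
  · change g₁ v.1 v.1 < 1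
    linarith
  · have : ‖√c • v.2‖ ≤ B := by
      refine hB _ ?_
      change g₂ (√c • v.2) (√c • v.2) < 1
      have : √c * (√c * g₂ v.2 v.2) = c * g₂ v.2 v.2 := by
        rw [← mul_assoc, Real.mul_self_sqrt hc.le]
      simp only [map_smul, _root_.smul_apply, smul_eq_mul]
      linarith
    rw [norm_smul, Real.norm_of_nonneg hs.le] at this
    rw [le_div_iff₀ hs]
    linarith
end

/-- The warped product metric `g₁ + f • g₂` on `M × M'`, for a positive smooth function `f` on `M`. -/
def warpedMetric [IsManifold I ∞ M] [IsManifold I' ∞ M'] (g₁ : ContMDiffRiemannianMetric I ∞ E (fun x : M => TangentSpace I x))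
    (f : M → ℝ) (hf : ContMDiff I 𝓘(ℝ, ℝ) ∞ f) (hf₀ : ∀ x, 0 < f x)
    (g₂ : ContMDiffRiemannianMetric I' ∞ E' (fun x : M' => TangentSpace I' x)) :
    ContMDiffRiemannianMetric (I.prod I') ∞ (E × E')
      (fun p : M × M' => TangentSpace (I.prod I') p) where
  inner p := prodBilin (V := E) (W := E') (g₁.inner p.1) (f p.1) (g₂.inner p.2)
  symm p := prodBilin_symm (V := E) (W := E') _ _ _ (g₁.symm p.1) (g₂.symm p.2)
  pos p := prodBilin_pos (V := E) (W := E') _ _ _ (g₁.pos p.1) (hf₀ p.1) (g₂.pos p.2)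
  isVonNBounded p := prodBilin_bounded (V := E) (W := E') _ _ _ (g₁.pos p.1) (hf₀ p.1)
    (g₂.pos p.2) (g₁.isVonNBounded p.1) (g₂.isVonNBounded p.2)
  contMDiff p := by
    refine (contMDiffAt_bilin_iff (I := I.prod I') (M := M × M')
      (fun p => prodBilin (V := E) (W := E') (g₁.inner p.1) (f p.1) (g₂.inner p.2)) p).2 ?_
    have h1 := (contMDiffAt_bilin_iff g₁.inner p.1).1 (g₁.contMDiff p.1)
    have h2 := (contMDiffAt_bilin_iff g₂.inner p.2).1 (g₂.contMDiff p.2)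
    have h3 := (h1.comp p contMDiffAt_fst).prodMk_space
      ((hf.contMDiffAt.comp p contMDiffAt_fst).prodMk_space (h2.comp p contMDiffAt_snd))
    refine (((contDiff_prodBilin (V := E) (W := E')).contMDiff.contMDiffAt (n := ∞)).comp p h3).congr_of_eventuallyEq ?_
    filter_upwards [chart_source_mem_nhds (ModelProd H H') p] with q hq
    rw [tangentCoordChange_prod _ _ _ hq (mem_chart_source _ _)]
    rfl

theorem contDiff_prodMap {V W : Type*} [NormedAddCommGroup V] [NormedSpace ℝ V]
    [NormedAddCommGroup W] [NormedSpace ℝ W] :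
    ContDiff ℝ ∞ (fun t : (V →L[ℝ] V) × (W →L[ℝ] W) => t.1.prodMap t.2) :=
  (ContinuousLinearMap.prodMapL ℝ V V W W).contDiff

theorem contMDiffAt_prodEndo [IsManifold I 1 M] [IsManifold I' 1 M'] (J₁ : ∀ x : M, TangentSpace I x →L[ℝ] TangentSpace I x)
    (J₂ : ∀ x : M', TangentSpace I' x →L[ℝ] TangentSpace I' x) (p : M × M')
    (h₁ : ContMDiffAt I (I.prod 𝓘(ℝ, E →L[ℝ] E)) ∞
      (fun x : M => TotalSpace.mk' (E →L[ℝ] E)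
        (E := fun x : M => TangentSpace I x →L[ℝ] TangentSpace I x) x (J₁ x)) p.1)
    (h₂ : ContMDiffAt I' (I'.prod 𝓘(ℝ, E' →L[ℝ] E')) ∞
      (fun x : M' => TotalSpace.mk' (E' →L[ℝ] E')
        (E := fun x : M' => TangentSpace I' x →L[ℝ] TangentSpace I' x) x (J₂ x)) p.2) :
    ContMDiffAt (I.prod I') ((I.prod I').prod 𝓘(ℝ, E × E' →L[ℝ] E × E')) ∞
      (fun p : M × M' => TotalSpace.mk' (E × E' →L[ℝ] E × E')
        (E := fun p : M × M' => TangentSpace (I.prod I') p →L[ℝ] TangentSpace (I.prod I') p) p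
        (ContinuousLinearMap.prodMap (M₁ := E) (M₂ := E) (M₃ := E') (M₄ := E')
          (J₁ p.1) (J₂ p.2))) p := by
  refine (contMDiffAt_endo_iff (I := I.prod I') (M := M × M')
      (fun p => ContinuousLinearMap.prodMap (M₁ := E) (M₂ := E) (M₃ := E') (M₄ := E')
          (J₁ p.1) (J₂ p.2)) p).2 ?_
  have h1 := (contMDiffAt_endo_iff J₁ p.1).1 h₁
  have h2 := (contMDiffAt_endo_iff J₂ p.2).1 h₂
  have h3 := (h1.comp p contMDiffAt_fst).prodMk_space (h2.comp p contMDiffAt_snd)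
  refine (((contDiff_prodMap (V := E) (W := E')).contMDiff.contMDiffAt (n := ∞)).comp p h3).congr_of_eventuallyEq ?_
  filter_upwards [chart_source_mem_nhds (ModelProd H H') p] with q hq
  rw [tangentCoordChange_prod _ _ _ hq (mem_chart_source _ _),
    tangentCoordChange_prod _ _ _ (mem_chart_source _ _) hq]
  rfl

/-- The warped product of two almost Hermitian manifolds: the metric `g₁ + f • g₂` and the product
almost complex structure `(v, w) ↦ (J₁ v, J₂ w)`. -/
def AlmostHermitianStructure.warpedProduct [IsManifold I ∞ M] [IsManifold I' ∞ M']
    (S : AlmostHermitianStructure I M) (f : M → ℝ) (hf : ContMDiff I 𝓘(ℝ, ℝ) ∞ f)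
    (hf₀ : ∀ x, 0 < f x) (T : AlmostHermitianStructure I' M') :
    AlmostHermitianStructure (I.prod I') (M × M') where
  metric := warpedMetric S.metric f hf hf₀ T.metric
  J p := ContinuousLinearMap.prodMap (M₁ := E) (M₂ := E) (M₃ := E') (M₄ := E')
    (S.J p.1) (T.J p.2)
  contMDiff_J p := contMDiffAt_prodEndo S.J T.J p (S.contMDiff_J p.1) (T.contMDiff_J p.2)
  J_J p v := Prod.ext (S.J_J p.1 v.1) (T.J_J p.2 v.2)
  inner_J_J p v w := congrArg₂ (fun a b : ℝ => a + f p.1 * b)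
    (S.inner_J_J p.1 v.1 w.1) (T.inner_J_J p.2 v.2 w.2)

end WarpedProduct

/-! ### The upper half plane -/

instance UpperHalfPlane.isManifold_real : IsManifold 𝓘(ℝ, ℂ) ∞ UpperHalfPlane :=
  UpperHalfPlane.isOpenEmbedding_coe.isManifold_singleton

theorem UpperHalfPlane.tangentCoordChange_eq (x y z : UpperHalfPlane) :
    tangentCoordChange 𝓘(ℝ, ℂ) x y z = ContinuousLinearMap.id ℝ ℂ :=
  ContinuousLinearMap.ext fun v =>
    tangentCoordChange_self (I := 𝓘(ℝ, ℂ)) (x := z) (z := z) (v := v) (by simp)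

theorem I_smul_I_smul (v : ℂ) : Complex.I • Complex.I • v = -v := by
  rw [smul_smul, Complex.I_mul_I, neg_one_smul]

theorem inner_I_smul (v w : ℂ) : inner ℝ (Complex.I • v) (Complex.I • w) = inner ℝ v w := by
  simp [Complex.inner]

/-- The flat metric `dw ⊗ dw̄`, i.e. `dw₁² + dw₂²`, and the standard complex structure on the upper
half plane. The tangent spaces are identified with `ℂ` by `dw`, as the inclusion into `ℂ` is the only
chart. -/
def flatUpperHalfPlane : AlmostHermitianStructure 𝓘(ℝ, ℂ) UpperHalfPlane where
  metric :=
    { inner := fun _ => (innerSL ℝ : ℂ →L[ℝ] ℂ →L[ℝ] ℝ)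
      symm := fun _ v w => real_inner_comm (F := ℂ) w v
      pos := fun _ v hv => real_inner_self_pos (F := ℂ).2 hv
      isVonNBounded := fun w => (riemannianMetricVectorSpace ℂ).isVonNBounded w.coe
      contMDiff := fun x => by
        refine (contMDiffAt_bilin_iff (I := 𝓘(ℝ, ℂ)) (M := UpperHalfPlane)
          (fun _ => (innerSL ℝ : ℂ →L[ℝ] ℂ →L[ℝ] ℝ)) x).2 ?_
        simp only [UpperHalfPlane.tangentCoordChange_eq]
        exact contMDiffAt_const }
  J _ := Complex.I • ContinuousLinearMap.id ℝ ℂ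
  contMDiff_J x := by
    refine (contMDiffAt_endo_iff (I := 𝓘(ℝ, ℂ)) (M := UpperHalfPlane)
      (fun _ => (Complex.I • ContinuousLinearMap.id ℝ ℂ : ℂ →L[ℝ] ℂ)) x).2 ?_
    simp only [UpperHalfPlane.tangentCoordChange_eq]
    exact contMDiffAt_const (c := (Complex.I • ContinuousLinearMap.id ℝ ℂ : ℂ →L[ℝ] ℂ))
  J_J _ := I_smul_I_smul
  inner_J_J _ := inner_I_smul

/-- The function `w ↦ w₂ ^ (2 / (n - 1))` on the upper half plane. -/
def heightPower (n : ℕ) (w : UpperHalfPlane) : ℝ := w.im ^ (2 / ((n : ℝ) - 1))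

theorem heightPower_pos (n : ℕ) (w : UpperHalfPlane) : 0 < heightPower n w :=
  Real.rpow_pos_of_pos w.im_pos _

theorem contMDiff_heightPower (n : ℕ) : ContMDiff 𝓘(ℝ, ℂ) 𝓘(ℝ, ℝ) ∞ (heightPower n) := by
  intro w
  have h1 : ContMDiffAt 𝓘(ℝ, ℂ) 𝓘(ℝ, ℂ) ∞ (UpperHalfPlane.coe) w := contMDiffAt_extChartAt
  have h2 : ContDiffAt ℝ ∞ (fun z : ℂ => z.im ^ (2 / ((n : ℝ) - 1))) (w : ℂ) :=
    (Complex.imCLM.contDiff.contDiffAt).rpow_const_of_ne w.im_pos.ne'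
  exact h2.contMDiffAt.comp w h1

/-- The manifold `H × K` with the metric `dw ⊗ dw̄ + w₂ ^ (2 / (n - 1)) k` and the product complex
structure, where `H` is the upper half plane and `k` is the metric of `K`. -/
def warpedUpperHalfPlane {E : Type*} [NormedAddCommGroup E] [NormedSpace ℝ E]
    {H : Type*} [TopologicalSpace H] {I : ModelWithCorners ℝ E H}
    {K : Type*} [TopologicalSpace K] [ChartedSpace H K] [IsManifold I ∞ K]
    (n : ℕ) (S : AlmostHermitianStructure I K) :
    AlmostHermitianStructure (𝓘(ℝ, ℂ).prod I) (UpperHalfPlane × K) :=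
  flatUpperHalfPlane.warpedProduct (heightPower n) (contMDiff_heightPower n) (heightPower_pos n) S

end

/-! Write y = w₂, ∂ for the unit vector ∂/∂w₂ and p = 2 / (n - 1). The exponent is tuned so that p
times the real dimension 2(n - 1) of K is 4.

In a `(1,2)`-symplectic manifold (∇_X J)Y + (∇_{JX} J)JY = 0 (`covDerivJ_add`). Differentiating dφ ∘
J = J' ∘ dφ therefore makes the second derivatives of φ cancel in pairs v, Jv, up to derivatives of
J on the source (`J_pullbackHessL_add`). In the w-plane J is constant and the Christoffel symbols
vanish, so this part contributes nothing to the tension field. Along a fibre, computed with the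
connection of k, the trace vanishes as well: a holomorphic map from a Kähler manifold to a
`(1,2)`-symplectic one is harmonic. All that survives is the bending of the fibres: the connection
of g differs from that of k by -(p y^(p-1) / 2) k(u, v) ∂, and its trace gives τ = f dφ(∂) with f =
2 / y (`tension_eq`).

In the bitension field, commuting covariant derivatives turns ∇_u ∇_v dφ(∂) together with the
curvature term into the derivative along ∂ of ∇_u dφ(v)
(`pullbackDeriv_pullbackHessL_add_curvature`). The traces of the latter, corrected by the fibre
connection, vanish along the ∂-lines, so their derivatives vanish too. What remains is (f'' + f f')
dφ(∂) + (2f' + f²) ∇_∂ dφ(∂), and both coefficients vanish for f = 2 / y (`bitension_eq_zero`).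

All this is done in coordinates and carried over through product charts. For the second claim, the
projection to the half plane has tension field (2 / y) i, which is never zero. -/

noncomputable section

set_option synthInstance.maxHeartbeats 400000
set_option maxHeartbeats 1000000
set_option maxSynthPendingDepth 3

/-! ### Levi-Civita connection in coordinates -/

section CoordinateGeometry

variable {E : Type*} [NormedAddCommGroup E] [NormedSpace ℝ E]

/-- A smooth Riemannian metric on an open subset of a vector space. -/
structure IsRiemannianMetricOn (G : E → E →L[ℝ] E →L[ℝ] ℝ) (s : Set E) : Prop where
  isOpen : IsOpen s
  contDiffOn : ContDiffOn ℝ ∞ G s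
  symm : ∀ x ∈ s, ∀ u v, G x u v = G x v u
  pos : ∀ x ∈ s, ∀ v, v ≠ 0 → 0 < G x v v

/-- A definite form is injective into the dual, which has the same dimension. This is what gives
`inverse`, zero on non-invertible maps, its intended meaning in `christoffel` and `metricTrace`. -/
theorem isInvertible_of_pos [FiniteDimensional ℝ E] {G : E →L[ℝ] E →L[ℝ] ℝ}
    (hG : ∀ v, v ≠ 0 → 0 < G v v) : G.IsInvertible := by
  have hinj : Function.Injective (G : E →ₗ[ℝ] E →L[ℝ] ℝ) := by
    refine (injective_iff_map_eq_zero _).2 fun v hv => ?_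
    by_contra h
    have h1 := hG v h
    have h2 : G v = 0 := hv
    simp [h2] at h1
  have hd : Module.finrank ℝ E = Module.finrank ℝ (E →L[ℝ] ℝ) := by
    rw [← LinearEquiv.finrank_eq (LinearMap.toContinuousLinearMap (𝕜 := ℝ) (E := E) (F' := ℝ))]
    exact (Subspace.dual_finrank_eq (K := ℝ) (V := E)).symm
  refine ⟨(LinearEquiv.ofInjectiveOfFinrankEq (G : E →ₗ[ℝ] E →L[ℝ] ℝ) hinj hd).toContinuousLinearEquiv, ?_⟩
  ext v w
  rfl

theorem IsRiemannianMetricOn.isInvertible [FiniteDimensional ℝ E] {G : E → E →L[ℝ] E →L[ℝ] ℝ}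
    {s : Set E} (hG : IsRiemannianMetricOn G s) {x : E} (hx : x ∈ s) : (G x).IsInvertible :=
  isInvertible_of_pos (hG.pos x hx)

theorem IsRiemannianMetricOn.contDiffAt {G : E → E →L[ℝ] E →L[ℝ] ℝ}
    {s : Set E} (hG : IsRiemannianMetricOn G s) {x : E} (hx : x ∈ s) : ContDiffAt ℝ ∞ G x :=
  hG.contDiffOn.contDiffAt (hG.isOpen.mem_nhds hx)

/-- The Christoffel symbol as a continuous bilinear map. -/
def christoffelL (G : E → E →L[ℝ] E →L[ℝ] ℝ) (x : E) : E →L[ℝ] E →L[ℝ] E :=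
  (ContinuousLinearMap.compL ℝ E (E →L[ℝ] ℝ) E (G x).inverse).comp
    ((1 / 2 : ℝ) • (fderiv ℝ G x + (fderiv ℝ G x).flip -
      ((ContinuousLinearMap.flipₗᵢ ℝ E E ℝ).toContinuousLinearEquiv :
        (E →L[ℝ] E →L[ℝ] ℝ) →L[ℝ] (E →L[ℝ] E →L[ℝ] ℝ)).comp (fderiv ℝ G x).flip))

theorem christoffelL_apply (G : E → E →L[ℝ] E →L[ℝ] ℝ) (x u v : E) :
    christoffelL G x u v = christoffel G x u v := rfl

theorem fderiv_apply_const {F' : Type*} [NormedAddCommGroup F'] [NormedSpace ℝ F']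
    {F : Type*} [NormedAddCommGroup F] [NormedSpace ℝ F]
    {G : E → F →L[ℝ] F'} {x : E} (hG : DifferentiableAt ℝ G x) (u : E) (v : F) :
    fderiv ℝ (fun y => G y v) x u = fderiv ℝ G x u v := by
  rw [fderiv_clm_apply hG (differentiableAt_const v)]
  simp

variable [FiniteDimensional ℝ E] {G : E → E →L[ℝ] E →L[ℝ] ℝ} {s : Set E} {x : E}

theorem IsRiemannianMetricOn.contDiffAt_christoffelL (hG : IsRiemannianMetricOn G s)
    (hx : x ∈ s) : ContDiffAt ℝ ∞ (christoffelL G) x := by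
  have h1 : ContDiffAt ℝ ∞ (fderiv ℝ G) x := (hG.contDiffAt hx).fderiv_right (by simp)
  have h2 : ContDiffAt ℝ ∞ (fun y => (G y).inverse) x := by
    have := (hG.isInvertible hx).contDiffAt_map_inverse (n := ∞)
    exact this.comp x (hG.contDiffAt hx)
  have h3 : ContDiffAt ℝ ∞ (fun y => (fderiv ℝ G y).flip) x :=
    (ContinuousLinearMap.flipₗᵢ ℝ E E (E →L[ℝ] ℝ)).toContinuousLinearEquiv.contDiff.contDiffAt.comp
      x h1
  unfold christoffelL
  refine ContDiffAt.clm_comp ?_ ?_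
  · exact (ContinuousLinearMap.compL ℝ E (E →L[ℝ] ℝ) E).contDiff.contDiffAt.comp x h2
  · exact ((h1.add h3).sub (contDiffAt_const.clm_comp h3)).const_smul (1 / 2 : ℝ)

theorem IsRiemannianMetricOn.inner_christoffel (hG : IsRiemannianMetricOn G s) (hx : x ∈ s)
    (u v w : E) : G x (christoffel G x u v) w =
      (fderiv ℝ G x u v w + fderiv ℝ G x v u w - fderiv ℝ G x w u v) / 2 := by
  rw [christoffel, (hG.isInvertible hx).self_apply_inverse]
  simp
  ring

omit [FiniteDimensional ℝ E] in
theorem IsRiemannianMetricOn.fderiv_symm (hG : IsRiemannianMetricOn G s) (hx : x ∈ s)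
    (u v w : E) : fderiv ℝ G x u v w = fderiv ℝ G x u w v := by
  have hd := (hG.contDiffAt hx).differentiableAt (by simp)
  have hd' : ∀ v, DifferentiableAt ℝ (fun y => G y v) x := fun v => hd.clm_apply (by fun_prop)
  rw [← fderiv_apply_const hd, ← fderiv_apply_const hd, ← fderiv_apply_const (hd' v),
    ← fderiv_apply_const (hd' w)]
  congr 1
  refine Filter.EventuallyEq.fderiv_eq ?_
  filter_upwards [hG.isOpen.mem_nhds hx] with y hy using hG.symm y hy v w

theorem IsRiemannianMetricOn.christoffel_symm (hG : IsRiemannianMetricOn G s) (hx : x ∈ s)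
    (u v : E) : christoffel G x u v = christoffel G x v u := by
  refine (hG.isInvertible hx).injective (ContinuousLinearMap.ext fun w => ?_)
  rw [hG.inner_christoffel hx, hG.inner_christoffel hx, hG.fderiv_symm hx w u v]
  ring

/-- Metric compatibility ∇G = 0, from adding two instances of Koszul's formula. With
`christoffel_symm` (no torsion) it is all that the Hermitian part needs from the connection. -/
theorem IsRiemannianMetricOn.fderiv_eq (hG : IsRiemannianMetricOn G s) (hx : x ∈ s)
    (u v w : E) : fderiv ℝ G x u v w =
      G x (christoffel G x u v) w + G x v (christoffel G x u w) := by
  rw [hG.symm x hx v, hG.inner_christoffel hx, hG.inner_christoffel hx, hG.fderiv_symm hx u w v,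
    hG.fderiv_symm hx w u v, hG.fderiv_symm hx v u w]
  ring

theorem christoffel_eq_of_inner (hG : IsRiemannianMetricOn G s) (hx : x ∈ s) {u v z : E}
    (h : ∀ w, G x z w = (fderiv ℝ G x u v w + fderiv ℝ G x v u w - fderiv ℝ G x w u v) / 2) :
    christoffel G x u v = z :=
  (hG.isInvertible hx).injective (ContinuousLinearMap.ext fun w => by
    rw [hG.inner_christoffel hx, h])

end CoordinateGeometry

/-! ### Metric traces -/

section Trace

variable {E : Type*} [NormedAddCommGroup E] [NormedSpace ℝ E] [FiniteDimensional ℝ E]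
  {F : Type*} [NormedAddCommGroup F] [NormedSpace ℝ F]

/-- Independence of the basis: a change of basis acts on vectors and on coordinate forms by mutually
inverse matrices. It needs `B` bilinear, which is why the tensors traced later are packaged as
continuous bilinear maps. -/
theorem metricTrace_eq_sum (G : E →L[ℝ] E →L[ℝ] ℝ) (B : E →L[ℝ] E →L[ℝ] F)
    {ι : Type*} [Fintype ι] (b : Module.Basis ι ℝ E) :
    metricTrace G (fun u v => B u v) =
      ∑ i, B (b i) (G.inverse (LinearMap.toContinuousLinearMap (b.coord i))) := by
  set f := Module.finBasis ℝ E with hf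
  have h1 : ∀ i, b i = ∑ j, f.coord j (b i) • f j := fun i => (f.sum_repr (b i)).symm
  have h2 : ∀ j, f.coord j = ∑ i, f.coord j (b i) • b.coord i := fun j => by
    refine b.ext fun k => ?_
    rw [LinearMap.sum_apply, Finset.sum_eq_single k] <;> simp +contextual
  have h3 : ∀ i, B (b i) (G.inverse (LinearMap.toContinuousLinearMap (b.coord i))) =
      ∑ j, f.coord j (b i) • B (f j) (G.inverse (LinearMap.toContinuousLinearMap (b.coord i))) :=
    fun i => by
      conv_lhs => rw [h1 i]
      simp only [map_sum, map_smul, _root_.sum_apply, _root_.smul_apply]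
  have h4 : ∀ j, B (f j) (G.inverse (LinearMap.toContinuousLinearMap (f.coord j))) =
      ∑ i, f.coord j (b i) • B (f j) (G.inverse (LinearMap.toContinuousLinearMap (b.coord i))) :=
    fun j => by
      conv_lhs => rw [h2 j]
      simp only [map_sum, map_smul]
  unfold metricTrace
  simp only [h3, ← hf]
  rw [Finset.sum_comm]
  exact Finset.sum_congr rfl fun j _ => h4 j

omit [FiniteDimensional ℝ E] in
theorem inverse_eq_of_apply {G : E →L[ℝ] E →L[ℝ] ℝ} (hG : G.IsInvertible) {α : E →L[ℝ] ℝ} {v : E}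
    (h : ∀ w, G v w = α w) : G.inverse α = v :=
  hG.injective (by rw [hG.self_apply_inverse]; ext w; exact (h w).symm)

omit [NormedSpace ℝ F] in
theorem metricTrace_add (G : E →L[ℝ] E →L[ℝ] ℝ) (B C : E → E → F) :
    metricTrace G (fun u v => B u v + C u v) = metricTrace G B + metricTrace G C := by
  simp [metricTrace, Finset.sum_add_distrib]

theorem metricTrace_comp {F' : Type*} [NormedAddCommGroup F'] [NormedSpace ℝ F']
    (G : E →L[ℝ] E →L[ℝ] ℝ) (B : E → E → F) (A : F →L[ℝ] F') :
    metricTrace G (fun u v => A (B u v)) = A (metricTrace G B) := by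
  simp [metricTrace]

theorem metricTrace_smul (G : E →L[ℝ] E →L[ℝ] ℝ) (B : E → E → F) (c : ℝ) :
    metricTrace G (fun u v => c • B u v) = c • metricTrace G B := by
  simp [metricTrace, Finset.smul_sum]

theorem metricTrace_self {G : E →L[ℝ] E →L[ℝ] ℝ} (hG : G.IsInvertible)
    (hs : ∀ u v, G u v = G v u) :
    metricTrace G (fun u v => G u v) = Module.finrank ℝ E := by
  unfold metricTrace
  have : ∀ i, G (Module.finBasis ℝ E i)
      (G.inverse (LinearMap.toContinuousLinearMap ((Module.finBasis ℝ E).coord i))) = 1 := by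
    intro i
    rw [hs, hG.self_apply_inverse]
    simp
  simp [this]

/-- An isometry carries a basis and its `G`-dual basis to another such pair, and the trace does not
depend on the pair. Here the inverse of `J` is `-J`. -/
theorem metricTrace_comp_orthogonal {G : E →L[ℝ] E →L[ℝ] ℝ} (hG : G.IsInvertible)
    (J : E →L[ℝ] E) (hJ : ∀ v, J (J v) = -v) (hGJ : ∀ u v, G (J u) (J v) = G u v)
    (B : E →L[ℝ] E →L[ℝ] F) :
    metricTrace G (fun u v => B (J u) (J v)) = metricTrace G (fun u v => B u v) := by
  let Je : E ≃ₗ[ℝ] E := LinearEquiv.ofLinearMap (J : E →ₗ[ℝ] E) (-(J : E →ₗ[ℝ] E))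
    (by ext v; simp [hJ]) (by ext v; simp [hJ])
  rw [metricTrace_eq_sum G B ((Module.finBasis ℝ E).map Je)]
  unfold metricTrace
  refine Finset.sum_congr rfl fun i _ => ?_
  refine congrArg (B (J (Module.finBasis ℝ E i))) ?_
  symm
  refine inverse_eq_of_apply hG fun w => ?_
  have : w = J (-(J w)) := by simp [hJ]
  conv_lhs => rw [this, hGJ, hG.self_apply_inverse]
  rfl

/-- Polarisation upgrades the diagonal hypothesis to B(u, v) + B(Ju, Jv) = 0. Taking the trace,
which is `J`-invariant, gives 2 tr B = 0. -/
theorem metricTrace_eq_zero {G : E →L[ℝ] E →L[ℝ] ℝ} (hG : G.IsInvertible)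
    (J : E →L[ℝ] E) (hJ : ∀ v, J (J v) = -v) (hGJ : ∀ u v, G (J u) (J v) = G u v)
    (B : E →L[ℝ] E →L[ℝ] F) (hB : ∀ u v, B u v = B v u)
    (h : ∀ v, B v v + B (J v) (J v) = 0) :
    metricTrace G (fun u v => B u v) = 0 := by
  have h1 : ∀ u v, B u v + B (J u) (J v) = 0 := by
    intro u v
    have e := h (u + v)
    simp only [map_add, _root_.add_apply] at e
    rw [hB v u, hB (J v) (J u)] at e
    have e2 : (2 : ℝ) • (B u v + B (J u) (J v)) =
        (B u u + B u v + (B u v + B v v) + (B (J u) (J u) + B (J u) (J v) +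
        (B (J u) (J v) + B (J v) (J v)))) - (B u u + B (J u) (J u))
        - (B v v + B (J v) (J v)) := by module
    rw [e, h u, h v] at e2
    have e3 : (2 : ℝ) • (B u v + B (J u) (J v)) = 0 := by rw [e2]; simp
    exact (smul_eq_zero.1 e3).resolve_left two_ne_zero
  have h2 : metricTrace G (fun u v => B u v + B (J u) (J v)) = 0 := by
    simp [metricTrace, h1]
  rw [metricTrace_add, metricTrace_comp_orthogonal hG J hJ hGJ] at h2
  have h3 : (2 : ℝ) • metricTrace G (fun u v => B u v) = 0 := by rw [two_smul, h2]
  simpa using h3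

theorem innerSL_complex_apply (u v : ℂ) :
    (innerSL ℝ : ℂ →L[ℝ] ℂ →L[ℝ] ℝ) u v = u.re * v.re + u.im * v.im := by
  change inner ℝ u v = _
  simp [Complex.inner]
  ring

/-- Use the basis 1, i of the plane, which is its own dual, followed by a basis of the fibre, whose
dual vectors are rescaled by `c⁻¹`. Mixed entries never occur, so mixed Christoffel symbols of the
warped metric are not needed later. -/
theorem metricTrace_prodBilin {k : E →L[ℝ] E →L[ℝ] ℝ} (hk : ∀ v, v ≠ 0 → 0 < k v v)
    {c : ℝ} (hc : 0 < c) (B : ℂ × E →L[ℝ] ℂ × E →L[ℝ] F) :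
    metricTrace (prodBilin (innerSL ℝ : ℂ →L[ℝ] ℂ →L[ℝ] ℝ) c k) (fun u v => B u v) =
      B (1, 0) (1, 0) + B (Complex.I, 0) (Complex.I, 0) +
        c⁻¹ • metricTrace k (fun u v => B (0, u) (0, v)) := by
  have hG : (prodBilin (innerSL ℝ : ℂ →L[ℝ] ℂ →L[ℝ] ℝ) c k).IsInvertible :=
    isInvertible_of_pos (prodBilin_pos _ _ _ (fun v hv => real_inner_self_pos (F := ℂ).2 hv) hc hk)
  have hk' := isInvertible_of_pos hk
  rw [metricTrace_eq_sum _ B (Complex.basisOneI.prod (Module.finBasis ℝ E)), Fintype.sum_sum_type,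
    Fin.sum_univ_two]
  congr 1
  · congr 1
    · have : (prodBilin (innerSL ℝ : ℂ →L[ℝ] ℂ →L[ℝ] ℝ) c k).inverse (LinearMap.toContinuousLinearMap
        ((Complex.basisOneI.prod (Module.finBasis ℝ E)).coord (Sum.inl 0))) = (1, 0) := by
        refine inverse_eq_of_apply hG fun w => ?_
        refine (congrArg (· + _) (innerSL_complex_apply _ _)).trans ?_
        simp
      rw [this]; simp
    · have : (prodBilin (innerSL ℝ : ℂ →L[ℝ] ℂ →L[ℝ] ℝ) c k).inverse (LinearMap.toContinuousLinearMap
        ((Complex.basisOneI.prod (Module.finBasis ℝ E)).coord (Sum.inl 1))) = (Complex.I, 0) := by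
        refine inverse_eq_of_apply hG fun w => ?_
        refine (congrArg (· + _) (innerSL_complex_apply _ _)).trans ?_
        simp
      rw [this]; simp
  · unfold metricTrace
    rw [Finset.smul_sum]
    refine Finset.sum_congr rfl fun i _ => ?_
    have : (prodBilin (innerSL ℝ : ℂ →L[ℝ] ℂ →L[ℝ] ℝ) c k).inverse (LinearMap.toContinuousLinearMap
        ((Complex.basisOneI.prod (Module.finBasis ℝ E)).coord (Sum.inr i))) = c⁻¹ • (0, k.inverse
          (LinearMap.toContinuousLinearMap ((Module.finBasis ℝ E).coord i))) := by
      refine inverse_eq_of_apply hG fun w => ?_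
      simp [prodBilin_apply, hk'.self_apply_inverse, hc.ne']
    rw [this, map_smul]; simp

end Trace

/-! ### The pull-back connection -/

section Pullback

variable {E : Type*} [NormedAddCommGroup E] [NormedSpace ℝ E]
  {F : Type*} [NormedAddCommGroup F] [NormedSpace ℝ F] [FiniteDimensional ℝ F]
  {h : F → F →L[ℝ] F →L[ℝ] ℝ} {t : Set F} {φ V : E → F} {x : E}

omit [FiniteDimensional ℝ F] in
theorem contDiffAt_fderiv (hφ : ContDiffAt ℝ ∞ φ x) : ContDiffAt ℝ ∞ (fderiv ℝ φ) x :=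
  hφ.fderiv_right (by simp)

omit [FiniteDimensional ℝ F] in
theorem contDiffAt_fderiv_apply (hφ : ContDiffAt ℝ ∞ φ x) (u : E) :
    ContDiffAt ℝ ∞ (fun y => fderiv ℝ φ y u) x :=
  (contDiffAt_fderiv hφ).clm_apply contDiffAt_const

theorem IsRiemannianMetricOn.contDiffAt_christoffel_comp (hh : IsRiemannianMetricOn h t)
    (hφ : ContDiffAt ℝ ∞ φ x) (hx : φ x ∈ t) :
    ContDiffAt ℝ ∞ (fun y => christoffelL h (φ y)) x :=
  (hh.contDiffAt_christoffelL hx).comp x hφ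

omit [FiniteDimensional ℝ F] in
theorem isSymmSndFDerivAt_of_smooth (hφ : ContDiffAt ℝ ∞ φ x) : IsSymmSndFDerivAt ℝ φ x :=
  hφ.isSymmSndFDerivAt (by
    rw [minSmoothness_of_isRCLikeNormedField]
    exact WithTop.coe_le_coe.2 (le_top : (2 : ℕ∞) ≤ ⊤))

/-- The pull-back connection as a continuous linear map in the direction of differentiation. -/
def pullbackDerivL (h : F → F →L[ℝ] F →L[ℝ] ℝ) (φ V : E → F) (x : E) : E →L[ℝ] F :=
  fderiv ℝ V x + ((christoffelL h (φ x)).flip (V x)).comp (fderiv ℝ φ x)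

omit [FiniteDimensional ℝ F] in
theorem pullbackDerivL_apply (u : E) : pullbackDerivL h φ V x u = pullbackDeriv h φ V x u := rfl

omit [FiniteDimensional ℝ F] in
theorem pullbackDeriv_congr {W : E → F} (hVW : V =ᶠ[nhds x] W) (u : E) :
    pullbackDeriv h φ V x u = pullbackDeriv h φ W x u := by
  rw [pullbackDeriv, pullbackDeriv, hVW.fderiv_eq, hVW.eq_of_nhds]

omit [FiniteDimensional ℝ F] in
theorem pullbackDeriv_smul {a : E → ℝ} (ha : DifferentiableAt ℝ a x) (hV : DifferentiableAt ℝ V x)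
    (u : E) : pullbackDeriv h φ (fun y => a y • V y) x u =
      fderiv ℝ a x u • V x + a x • pullbackDeriv h φ V x u := by
  simp only [pullbackDeriv, ← christoffelL_apply]
  rw [fderiv_fun_smul ha hV]
  simp
  module

omit [FiniteDimensional ℝ F] in
theorem pullbackDeriv_add {W : E → F} (hV : DifferentiableAt ℝ V x) (hW : DifferentiableAt ℝ W x)
    (u : E) : pullbackDeriv h φ (fun y => V y + W y) x u =
      pullbackDeriv h φ V x u + pullbackDeriv h φ W x u := by
  simp only [pullbackDeriv, ← christoffelL_apply]
  rw [fderiv_fun_add hV hW]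
  simp
  module

omit [FiniteDimensional ℝ F] in
theorem pullbackDeriv_dir_add (u v : E) : pullbackDeriv h φ V x (u + v) =
      pullbackDeriv h φ V x u + pullbackDeriv h φ V x v := by
  simp only [← pullbackDerivL_apply, map_add]

omit [FiniteDimensional ℝ F] in
theorem pullbackDeriv_dir_smul (c : ℝ) (u : E) : pullbackDeriv h φ V x (c • u) =
      c • pullbackDeriv h φ V x u := by
  simp only [← pullbackDerivL_apply, map_smul]

/-- `∇^φ_u (dφ v)` as a continuous bilinear map. -/
def pullbackHessL (h : F → F →L[ℝ] F →L[ℝ] ℝ) (φ : E → F) (x : E) : E →L[ℝ] E →L[ℝ] F :=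
  fderiv ℝ (fderiv ℝ φ) x + (christoffelL h (φ x)).bilinearComp (fderiv ℝ φ x) (fderiv ℝ φ x)

omit [FiniteDimensional ℝ F] in
theorem pullbackHessL_apply (hφ : ContDiffAt ℝ ∞ φ x) (u v : E) :
    pullbackDeriv h φ (fun y => fderiv ℝ φ y v) x u = pullbackHessL h φ x u v := by
  rw [pullbackDeriv, fderiv_apply_const ((contDiffAt_fderiv hφ).differentiableAt (by simp))]
  rfl

/-- The target connection has no torsion and second derivatives commute. -/
theorem pullbackHessL_symm (hh : IsRiemannianMetricOn h t) (hφ : ContDiffAt ℝ ∞ φ x)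
    (hx : φ x ∈ t) (u v : E) : pullbackHessL h φ x u v = pullbackHessL h φ x v u := by
  have h1 : IsSymmSndFDerivAt ℝ φ x := isSymmSndFDerivAt_of_smooth hφ
  change fderiv ℝ (fderiv ℝ φ) x u v + christoffel h (φ x) (fderiv ℝ φ x u) (fderiv ℝ φ x v) =
    fderiv ℝ (fderiv ℝ φ) x v u + christoffel h (φ x) (fderiv ℝ φ x v) (fderiv ℝ φ x u)
  rw [h1.eq, hh.christoffel_symm hx]

/-- The curvature of the pull-back connection is the pull-back of the curvature: after
antisymmetrising, the second derivatives of `φ` and `V` cancel and only derivatives and products of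
Christoffel symbols remain. -/
theorem IsRiemannianMetricOn.pullbackDeriv_comm (hh : IsRiemannianMetricOn h t)
    (hφ : ContDiffAt ℝ ∞ φ x) (hV : ContDiffAt ℝ ∞ V x) (hx : φ x ∈ t) (u v : E) :
    pullbackDeriv h φ (fun y => pullbackDeriv h φ V y v) x u
      - pullbackDeriv h φ (fun y => pullbackDeriv h φ V y u) x v =
      curvature h (φ x) (fderiv ℝ φ x u) (fderiv ℝ φ x v) (V x) := by
  have dφ := hφ.differentiableAt (by simp)
  have dV := hV.differentiableAt (by simp)
  have dΓ := (hh.contDiffAt_christoffelL hx).differentiableAt (by simp)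
  have key : ∀ u v : E, fderiv ℝ (fun y => pullbackDeriv h φ V y v) x u =
      fderiv ℝ (fderiv ℝ V) x u v
      + fderiv ℝ (christoffelL h) (φ x) (fderiv ℝ φ x u) (fderiv ℝ φ x v) (V x)
      + christoffelL h (φ x) (fderiv ℝ (fderiv ℝ φ) x u v) (V x)
      + christoffelL h (φ x) (fderiv ℝ φ x v) (fderiv ℝ V x u) := by
    intro u v
    have c1 : DifferentiableAt ℝ (fun y => christoffelL h (φ y)) x :=
      (hh.contDiffAt_christoffel_comp hφ hx).differentiableAt (by simp)
    have c2 : DifferentiableAt ℝ (fun y => fderiv ℝ φ y v) x :=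
      (contDiffAt_fderiv_apply hφ v).differentiableAt (by simp)
    have c3 : DifferentiableAt ℝ (fun y => fderiv ℝ V y v) x :=
      (contDiffAt_fderiv_apply hV v).differentiableAt (by simp)
    have e : (fun y => pullbackDeriv h φ V y v) =
      fun y => fderiv ℝ V y v + christoffelL h (φ y) (fderiv ℝ φ y v) (V y) := rfl
    rw [e, fderiv_fun_add c3 ((c1.clm_apply c2).clm_apply dV),
      fderiv_clm_apply (c1.clm_apply c2) dV, fderiv_clm_apply c1 c2,
      show (fun y => christoffelL h (φ y)) = christoffelL h ∘ φ from rfl,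
      fderiv_comp x dΓ dφ]
    simp only [_root_.add_apply, ContinuousLinearMap.comp_apply, ContinuousLinearMap.flip_apply]
    rw [fderiv_apply_const ((contDiffAt_fderiv hφ).differentiableAt (by simp)),
      fderiv_apply_const ((contDiffAt_fderiv hV).differentiableAt (by simp))]
    abel
  have s1 : IsSymmSndFDerivAt ℝ φ x := isSymmSndFDerivAt_of_smooth hφ
  have s2 : IsSymmSndFDerivAt ℝ V x := isSymmSndFDerivAt_of_smooth hV
  have cΓ : ∀ a b c : F, fderiv ℝ (fun y => christoffel h y b c) (φ x) a =
      fderiv ℝ (christoffelL h) (φ x) a b c := by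
    intro a b c
    have d1 : DifferentiableAt ℝ (fun y => christoffelL h y b) (φ x) :=
      dΓ.clm_apply (differentiableAt_const b)
    rw [show (fun y => christoffel h y b c) = fun y => christoffelL h y b c from rfl,
      fderiv_apply_const d1, fderiv_apply_const dΓ]
  rw [curvature, cΓ, cΓ]
  -- `key` differentiates the inner covariant derivative; this adds the Christoffel term of the
  -- outer one.
  have e := fun u v => congrArg
    (· + christoffel h (φ x) (fderiv ℝ φ x u) (pullbackDeriv h φ V x v)) (key u v)
  refine (congrArg₂ (· - ·) (e u v) (e v u)).trans ?_
  rw [s1.eq u v, s2.eq u v]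
  simp only [pullbackDeriv, ← christoffelL_apply, map_add]
  abel

end Pullback

/-! ### Almost Hermitian structures in coordinates -/

section Hermitian

variable {E : Type*} [NormedAddCommGroup E] [NormedSpace ℝ E]

/-- A smooth almost Hermitian structure on an open subset of a vector space. -/
structure IsAlmostHermitianOn (G : E → E →L[ℝ] E →L[ℝ] ℝ) (J : E → E →L[ℝ] E) (s : Set E) : Prop
    extends IsRiemannianMetricOn G s where
  contDiffOn_J : ContDiffOn ℝ ∞ J s
  J_J : ∀ x ∈ s, ∀ v, J x (J x v) = -v
  inner_J_J : ∀ x ∈ s, ∀ u v, G x (J x u) (J x v) = G x u v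

/-- The covariant derivative `(∇_u J) v`. -/
def covDerivJ (G : E → E →L[ℝ] E →L[ℝ] ℝ) (J : E → E →L[ℝ] E) (x u v : E) : E :=
  fderiv ℝ J x u v + christoffel G x u (J x v) - J x (christoffel G x u v)

theorem covDerivJ_neg_left (G : E → E →L[ℝ] E →L[ℝ] ℝ) (J : E → E →L[ℝ] E) (x u v : E) :
    covDerivJ G J x (-u) v = -covDerivJ G J x u v := by
  simp only [covDerivJ, ← christoffelL_apply, map_neg, _root_.neg_apply]
  abel

theorem covDerivJ_neg_right (G : E → E →L[ℝ] E →L[ℝ] ℝ) (J : E → E →L[ℝ] E) (x u v : E) :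
    covDerivJ G J x u (-v) = -covDerivJ G J x u v := by
  simp only [covDerivJ, ← christoffelL_apply, map_neg]
  abel

variable {G : E → E →L[ℝ] E →L[ℝ] ℝ} {J : E → E →L[ℝ] E} {s : Set E} {x : E}

theorem IsAlmostHermitianOn.inner_J_left (hS : IsAlmostHermitianOn G J s) (hx : x ∈ s) (u v : E) :
    G x (J x u) v = -G x u (J x v) := by
  have h := hS.inner_J_J x hx u (J x v)
  rw [hS.J_J x hx, map_neg] at h
  linarith

theorem IsAlmostHermitianOn.differentiableAt_J (hS : IsAlmostHermitianOn G J s) (hx : x ∈ s) :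
    DifferentiableAt ℝ J x :=
  (hS.contDiffOn_J.contDiffAt (hS.isOpen.mem_nhds hx)).differentiableAt (by simp)

theorem IsAlmostHermitianOn.fderiv_J_J (hS : IsAlmostHermitianOn G J s) (hx : x ∈ s) (u v : E) :
    fderiv ℝ J x u (J x v) = -J x (fderiv ℝ J x u v) := by
  have hJ := hS.differentiableAt_J hx
  have h1 : fderiv ℝ (fun y => J y (J y v)) x u = 0 := by
    have : (fun y => J y (J y v)) =ᶠ[nhds x] fun _ => -v := by
      filter_upwards [hS.isOpen.mem_nhds hx] with y hy using hS.J_J y hy v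
    rw [this.fderiv_eq]
    simp
  rw [fderiv_clm_apply hJ (hJ.clm_apply (differentiableAt_const v))] at h1
  simp only [_root_.add_apply, ContinuousLinearMap.comp_apply, ContinuousLinearMap.flip_apply,
    fderiv_apply_const hJ] at h1
  rw [eq_neg_iff_add_eq_zero, add_comm]
  exact h1

/-- The covariant derivative of J² = -1: ∇J anticommutes with J. -/
theorem IsAlmostHermitianOn.covDerivJ_J (hS : IsAlmostHermitianOn G J s) (hx : x ∈ s) (u v : E) :
    covDerivJ G J x u (J x v) = -J x (covDerivJ G J x u v) := by
  simp only [covDerivJ, ← christoffelL_apply, hS.fderiv_J_J hx, hS.J_J x hx, map_add, map_sub,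
    map_neg]
  abel

variable [FiniteDimensional ℝ E]

theorem IsAlmostHermitianOn.fderiv_fundamentalForm (hS : IsAlmostHermitianOn G J s) (hx : x ∈ s)
    (u v w : E) : fderiv ℝ (fun y => fundamentalForm G J y v w) x u =
      G x v (covDerivJ G J x u w) + G x (christoffel G x u v) (J x w)
        + G x v (J x (christoffel G x u w)) := by
  have hJ := hS.differentiableAt_J hx
  have hG := (hS.contDiffAt hx).differentiableAt (by simp)
  unfold fundamentalForm
  rw [fderiv_clm_apply (hG.clm_apply (differentiableAt_const v))
    (hJ.clm_apply (differentiableAt_const w))]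
  simp only [_root_.add_apply, ContinuousLinearMap.comp_apply, ContinuousLinearMap.flip_apply,
    fderiv_apply_const hJ, fderiv_apply_const hG, hS.fderiv_eq hx, covDerivJ, map_add, map_sub]
  ring

omit [FiniteDimensional ℝ E] in
theorem IsAlmostHermitianOn.inner_covDerivJ_J (hS : IsAlmostHermitianOn G J s) (hx : x ∈ s)
    (u v w : E) : G x v (covDerivJ G J x u (J x w)) = G x (J x v) (covDerivJ G J x u w) := by
  rw [hS.covDerivJ_J hx, map_neg, hS.inner_J_left hx]

/-- Since ∇G = 0, (∇_u Ω)(v, w) = G(v, (∇_u J)w), and dΩ is the cyclic sum of ∇Ω because the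
Christoffel corrections cancel by symmetry of Γ and antisymmetry of Ω. -/
theorem IsAlmostHermitianOn.dFundamentalForm_eq (hS : IsAlmostHermitianOn G J s) (hx : x ∈ s)
    (u v w : E) : dFundamentalForm G J x u v w = G x v (covDerivJ G J x u w)
      + G x w (covDerivJ G J x v u) + G x u (covDerivJ G J x w v) := by
  rw [dFundamentalForm, hS.fderiv_fundamentalForm hx, hS.fderiv_fundamentalForm hx,
    hS.fderiv_fundamentalForm hx]
  have e : ∀ a b : E, G x a (J x b) = -G x b (J x a) := fun a b => by
    rw [hS.symm x hx, hS.inner_J_left hx]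
  rw [hS.christoffel_symm hx v u, hS.christoffel_symm hx w u, hS.christoffel_symm hx w v,
    e (christoffel G x u v), e (christoffel G x u w), e (christoffel G x v w)]
  ring

/-- The `(1,2)`-part of `dΩ` vanishes at the point `x`. -/
def IsOneTwoSymplecticAt (G : E → E →L[ℝ] E →L[ℝ] ℝ) (J : E → E →L[ℝ] E) (x : E) : Prop :=
  ∀ u v w : E, complexExtension (dFundamentalForm G J x)
      (u, -J x u) (v, J x v) (w, J x w) = 0

/-- The real part of the `(1,2)`-condition suffices. Expanded by `dFundamentalForm_eq`, its terms
with ∇_v, ∇_{Jv}, ∇_w, ∇_{Jw} cancel because ∇J anticommutes with J, and the others add up to twice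
the inner product of `v` with the left-hand side. -/
theorem IsAlmostHermitianOn.covDerivJ_add (hS : IsAlmostHermitianOn G J s) (hx : x ∈ s)
    (h12 : IsOneTwoSymplecticAt G J x) (u w : E) :
    covDerivJ G J x u w + covDerivJ G J x (J x u) (J x w) = 0 := by
  refine (hS.isInvertible hx).injective (ContinuousLinearMap.ext fun v => ?_)
  have h := congrArg Complex.re (h12 u v w)
  simp only [complexExtension, Complex.add_re, Complex.ofReal_re, Complex.mul_re, Complex.I_re,
    Complex.ofReal_im, Complex.I_im, Complex.zero_re, mul_zero, zero_mul, sub_zero, add_zero] at h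
  simp only [hS.dFundamentalForm_eq hx, covDerivJ_neg_left, covDerivJ_neg_right, map_neg,
    _root_.neg_apply, hS.inner_covDerivJ_J hx] at h
  simp only [hS.J_J x hx, map_neg, _root_.neg_apply] at h
  rw [map_add, map_zero, _root_.add_apply, hS.symm x hx _ v, hS.symm x hx _ v,
    hS.inner_covDerivJ_J hx, _root_.zero_apply]
  linarith

end Hermitian

/-! ### Holomorphic maps in coordinates -/

section Holomorphic

variable {E : Type*} [NormedAddCommGroup E] [NormedSpace ℝ E]
  {F : Type*} [NormedAddCommGroup F] [NormedSpace ℝ F] [FiniteDimensional ℝ F]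
  {h : F → F →L[ℝ] F →L[ℝ] ℝ} {J' : F → F →L[ℝ] F} {t : Set F} {J : E → E →L[ℝ] E} {φ : E → F} {x : E}

omit [FiniteDimensional ℝ F] in
-- The equation dφ ∘ J = J' ∘ dφ, differentiated covariantly along `u` using the connection of the
-- target only.
theorem IsAlmostHermitianOn.pullbackHessL_J (hT : IsAlmostHermitianOn h J' t)
    (hφ : ContDiffAt ℝ ∞ φ x) (hx : φ x ∈ t) (hJ : DifferentiableAt ℝ J x)
    (hol : ∀ᶠ y in nhds x, ∀ v, fderiv ℝ φ y (J y v) = J' (φ y) (fderiv ℝ φ y v)) (u v : E) :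
    pullbackHessL h φ x u (J x v) + fderiv ℝ φ x (fderiv ℝ J x u v) =
      covDerivJ h J' (φ x) (fderiv ℝ φ x u) (fderiv ℝ φ x v)
        + J' (φ x) (pullbackHessL h φ x u v) := by
  have dφ := hφ.differentiableAt (by simp)
  have ddφ := (contDiffAt_fderiv hφ).differentiableAt (by simp)
  have dJ' := hT.differentiableAt_J hx
  have e : fderiv ℝ (fun y => fderiv ℝ φ y (J y v)) x u =
      fderiv ℝ (fun y => J' (φ y) (fderiv ℝ φ y v)) x u := by
    have : (fun y => fderiv ℝ φ y (J y v)) =ᶠ[nhds x] fun y => J' (φ y) (fderiv ℝ φ y v) :=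
      hol.mono fun y hy => hy v
    rw [this.fderiv_eq]
  rw [fderiv_clm_apply ddφ (hJ.clm_apply (differentiableAt_const v)),
    fderiv_clm_apply (show DifferentiableAt ℝ (fun y => J' (φ y)) x from dJ'.comp x dφ)
      (ddφ.clm_apply (differentiableAt_const v)),
    show (fun y => J' (φ y)) = J' ∘ φ from rfl, fderiv_comp x dJ' dφ] at e
  simp only [_root_.add_apply, ContinuousLinearMap.comp_apply, ContinuousLinearMap.flip_apply,
    fderiv_apply_const hJ, fderiv_apply_const ddφ] at e
  have e0 := hol.self_of_nhds v
  change fderiv ℝ (fderiv ℝ φ) x u (J x v)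
    + christoffelL h (φ x) (fderiv ℝ φ x u) (fderiv ℝ φ x (J x v)) + _ =
    (_ + christoffelL h (φ x) (fderiv ℝ φ x u) (J' (φ x) (fderiv ℝ φ x v))
      - J' (φ x) (christoffelL h (φ x) (fderiv ℝ φ x u) (fderiv ℝ φ x v)))
      + J' (φ x) (fderiv ℝ (fderiv ℝ φ) x u v
        + christoffelL h (φ x) (fderiv ℝ φ x u) (fderiv ℝ φ x v))
  rw [e0, map_add, add_right_comm, add_comm (fderiv ℝ (fderiv ℝ φ) x u (J x v)), e]
  abel

/-- Add `pullbackHessL_J` for the pairs (v, v) and (Jv, Jv): the mixed terms Hess(v, Jv) cancel by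
symmetry and the ∇J' terms by `covDerivJ_add`. No connection on the source enters, so the identity
serves both the plane and the fibres. -/
theorem IsAlmostHermitianOn.J_pullbackHessL_add (hT : IsAlmostHermitianOn h J' t)
    (hφ : ContDiffAt ℝ ∞ φ x) (hx : φ x ∈ t) (h12 : IsOneTwoSymplecticAt h J' (φ x))
    (hJ : DifferentiableAt ℝ J x) (hJJ : ∀ v, J x (J x v) = -v)
    (hol : ∀ᶠ y in nhds x, ∀ v, fderiv ℝ φ y (J y v) = J' (φ y) (fderiv ℝ φ y v)) (v : E) :
    J' (φ x) (pullbackHessL h φ x v v + pullbackHessL h φ x (J x v) (J x v)) =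
      fderiv ℝ φ x (fderiv ℝ J x v v + fderiv ℝ J x (J x v) (J x v)) := by
  have e1 := hT.pullbackHessL_J hφ hx hJ hol v v
  have e2 := hT.pullbackHessL_J hφ hx hJ hol (J x v) (J x v)
  have e3 := hT.covDerivJ_add hx h12 (fderiv ℝ φ x v) (fderiv ℝ φ x v)
  rw [← hol.self_of_nhds v] at e3
  rw [hJJ, map_neg, pullbackHessL_symm hT.toIsRiemannianMetricOn hφ hx] at e2
  rw [map_add, map_add, ← sub_eq_iff_eq_add'.2 e1, ← sub_eq_iff_eq_add'.2 e2,
    eq_neg_of_add_eq_zero_left e3]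
  abel

end Holomorphic

/-! ### Holomorphic maps from warped products in coordinates -/

section Warped

variable {E : Type*} [NormedAddCommGroup E] [NormedSpace ℝ E]
  {F : Type*} [NormedAddCommGroup F] [NormedSpace ℝ F]

/-- The metric `dw ⊗ dw̄ + w₂ ^ p k` in coordinates. -/
def halfPlaneWarp (p : ℝ) (k : E → E →L[ℝ] E →L[ℝ] ℝ) (z : ℂ × E) :
    ℂ × E →L[ℝ] ℂ × E →L[ℝ] ℝ :=
  prodBilin (innerSL ℝ : ℂ →L[ℝ] ℂ →L[ℝ] ℝ) (z.1.im ^ p) (k z.2)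

/-- The complex structure of the product of a half plane and an almost complex manifold. -/
def halfPlaneProdJ (J : E → E →L[ℝ] E) (z : ℂ × E) : ℂ × E →L[ℝ] ℂ × E :=
  (Complex.I • ContinuousLinearMap.id ℝ ℂ : ℂ →L[ℝ] ℂ).prodMap (J z.2)

/-- A holomorphic map from the warped product of the upper half plane and an almost Hermitian
`(1,2)`-symplectic manifold to a `(1,2)`-symplectic manifold, in coordinates. -/
structure IsWarpedHolomorphicOn (p : ℝ) (g : ℂ × E → ℂ × E →L[ℝ] ℂ × E →L[ℝ] ℝ)
    (k : E → E →L[ℝ] E →L[ℝ] ℝ) (J : E → E →L[ℝ] E) (r : Set E)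
    (h : F → F →L[ℝ] F →L[ℝ] ℝ) (J' : F → F →L[ℝ] F) (t : Set F)
    (φ : ℂ × E → F) (s : Set (ℂ × E)) : Prop where
  isOpen : IsOpen s
  source : IsAlmostHermitianOn k J r
  target : IsAlmostHermitianOn h J' t
  source_symplectic : ∀ y ∈ r, IsOneTwoSymplecticAt k J y
  target_symplectic : ∀ y ∈ t, IsOneTwoSymplecticAt h J' y
  metric : ∀ z ∈ s, g z = halfPlaneWarp p k z
  im_pos : ∀ z ∈ s, 0 < z.1.im
  snd_mem : ∀ z ∈ s, z.2 ∈ r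
  map_mem : ∀ z ∈ s, φ z ∈ t
  contDiffOn : ContDiffOn ℝ ∞ φ s
  holomorphic : ∀ z ∈ s, ∀ v, fderiv ℝ φ z (halfPlaneProdJ J z v) = J' (φ z) (fderiv ℝ φ z v)

variable {p : ℝ} {g : ℂ × E → ℂ × E →L[ℝ] ℂ × E →L[ℝ] ℝ}
    {k : E → E →L[ℝ] E →L[ℝ] ℝ} {J : E → E →L[ℝ] E} {r : Set E}
    {h : F → F →L[ℝ] F →L[ℝ] ℝ} {J' : F → F →L[ℝ] F} {t : Set F}
    {φ : ℂ × E → F} {s : Set (ℂ × E)} {z : ℂ × E}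

theorem contDiffAt_prodBilin {X V W : Type*} [NormedAddCommGroup X] [NormedSpace ℝ X]
    [NormedAddCommGroup V] [NormedSpace ℝ V] [NormedAddCommGroup W] [NormedSpace ℝ W]
    (A : V →L[ℝ] V →L[ℝ] ℝ) {f : X → ℝ} {K : X → W →L[ℝ] W →L[ℝ] ℝ} {x : X}
    (hf : ContDiffAt ℝ ∞ f x) (hK : ContDiffAt ℝ ∞ K x) :
    ContDiffAt ℝ ∞ (fun y => prodBilin A (f y) (K y)) x := by
  have h1 : ContDiff ℝ ∞ (fun B : W →L[ℝ] W →L[ℝ] ℝ =>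
      B.bilinearComp (ContinuousLinearMap.snd ℝ V W) (ContinuousLinearMap.snd ℝ V W)) :=
    contDiff_bilinearComp _
  exact contDiffAt_const.add (hf.smul (h1.contDiffAt.comp x hK))

theorem contDiffAt_halfPlaneWarp (hz : 0 < z.1.im) (hk : ContDiffAt ℝ ∞ k z.2) :
    ContDiffAt ℝ ∞ (halfPlaneWarp p k) z := by
  have h1 : ContDiffAt ℝ ∞ (fun z : ℂ × E => z.1.im) z :=
    (Complex.imCLM.comp (ContinuousLinearMap.fst ℝ ℂ E)).contDiff.contDiffAt
  exact contDiffAt_prodBilin _ (h1.rpow_const_of_ne hz.ne') (hk.comp z contDiffAt_snd)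

theorem fderiv_halfPlaneWarp (hz : 0 < z.1.im) (hk : ContDiffAt ℝ ∞ k z.2) (u v w : ℂ × E) :
    fderiv ℝ (halfPlaneWarp p k) z u v w = p * z.1.im ^ (p - 1) * u.1.im * k z.2 v.2 w.2
      + z.1.im ^ p * fderiv ℝ k z.2 u.2 v.2 w.2 := by
  have d := (contDiffAt_halfPlaneWarp (p := p) hz hk).differentiableAt (by simp)
  have dk := hk.differentiableAt (by simp)
  have h1 : HasFDerivAt (fun z : ℂ × E => z.1.im ^ p) ((p * z.1.im ^ (p - 1)) •
      (Complex.imCLM.comp (ContinuousLinearMap.fst ℝ ℂ E))) z := by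
    have := (Complex.imCLM.comp (ContinuousLinearMap.fst ℝ ℂ E)).hasFDerivAt (x := z)
    exact this.rpow_const (Or.inl hz.ne')
  have h2 : HasFDerivAt (fun y : ℂ × E => k y.2)
      ((fderiv ℝ k z.2).comp (ContinuousLinearMap.snd ℝ ℂ E)) z :=
    dk.hasFDerivAt.comp z hasFDerivAt_snd
  have h3 : HasFDerivAt (fun y : ℂ × E => k y.2 v.2 w.2)
      ((((fderiv ℝ k z.2).comp (ContinuousLinearMap.snd ℝ ℂ E)).flip v.2).flip w.2) z := by
    have h4 := (h2.clm_apply (hasFDerivAt_const v.2 z)).clm_apply (hasFDerivAt_const w.2 z)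
    refine h4.congr_fderiv ?_
    ext <;> simp
  rw [← fderiv_apply_const d, ← fderiv_apply_const (d.clm_apply (differentiableAt_const v))]
  have e : (fun y => halfPlaneWarp p k y v w) = fun y : ℂ × E =>
      (innerSL ℝ : ℂ →L[ℝ] ℂ →L[ℝ] ℝ) v.1 w.1 + y.1.im ^ p * k y.2 v.2 w.2 := rfl
  have h5 : HasFDerivAt (fun y : ℂ × E => (innerSL ℝ : ℂ →L[ℝ] ℂ →L[ℝ] ℝ) v.1 w.1
      + y.1.im ^ p * k y.2 v.2 w.2) _ z := (h1.mul h3).const_add _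
  rw [e, h5.fderiv]
  simp
  ring

/-! ### Connection of the warped metric and the tension field -/

namespace IsWarpedHolomorphicOn

variable (H : IsWarpedHolomorphicOn p g k J r h J' t φ s)
include H

theorem mem_nhds (hz : z ∈ s) : s ∈ nhds z := H.isOpen.mem_nhds hz

theorem contDiffAt (hz : z ∈ s) : ContDiffAt ℝ ∞ φ z := H.contDiffOn.contDiffAt (H.mem_nhds hz)

theorem metric_eventuallyEq (hz : z ∈ s) : g =ᶠ[nhds z] halfPlaneWarp p k :=
  Filter.eventuallyEq_of_mem (H.mem_nhds hz) H.metric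

theorem contDiffAt_k (hz : z ∈ s) : ContDiffAt ℝ ∞ k z.2 :=
  H.source.toIsRiemannianMetricOn.contDiffAt (H.snd_mem z hz)

theorem isRiemannianMetricOn : IsRiemannianMetricOn g s where
  isOpen := H.isOpen
  contDiffOn z hz := ((contDiffAt_halfPlaneWarp (H.im_pos z hz)
    (H.contDiffAt_k hz)).congr_of_eventuallyEq (H.metric_eventuallyEq hz)).contDiffWithinAt
  symm z hz u v := by
    rw [H.metric z hz]
    exact prodBilin_symm _ _ _ (fun v w => real_inner_comm (F := ℂ) w v)
      (H.source.symm _ (H.snd_mem z hz)) u v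
  pos z hz v hv := by
    rw [H.metric z hz]
    exact prodBilin_pos _ _ _ (fun v hv => real_inner_self_pos (F := ℂ).2 hv)
      (Real.rpow_pos_of_pos (H.im_pos z hz) p) (H.source.pos _ (H.snd_mem z hz)) v hv

variable [FiniteDimensional ℝ E]

theorem christoffel_fst (hz : z ∈ s) (c : ℂ) : christoffel g z (c, 0) (c, 0) = 0 := by
  refine christoffel_eq_of_inner H.isRiemannianMetricOn hz fun w => ?_
  rw [(H.metric_eventuallyEq hz).fderiv_eq]
  simp only [fderiv_halfPlaneWarp (H.im_pos z hz) (H.contDiffAt_k hz)]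
  simp

/-- In Koszul's formula the term -∂_w G(u, v) / 2 also sees the derivative of the warping function.
The fibres are thus totally umbilical, and the normal part is a multiple of ∂/∂w₂. -/
theorem christoffel_snd (hz : z ∈ s) (u v : E) : christoffel g z (0, u) (0, v) =
    -(p * z.1.im ^ (p - 1) / 2 * k z.2 u v) • (Complex.I, (0 : E))
      + (0, christoffel k z.2 u v) := by
  refine christoffel_eq_of_inner H.isRiemannianMetricOn hz fun w => ?_
  rw [(H.metric_eventuallyEq hz).fderiv_eq, H.metric z hz]
  simp only [fderiv_halfPlaneWarp (H.im_pos z hz) (H.contDiffAt_k hz)]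
  have e := H.source.toIsRiemannianMetricOn.inner_christoffel (H.snd_mem z hz) u v w.2
  have e2 : (innerSL ℝ : ℂ →L[ℝ] ℂ →L[ℝ] ℝ) Complex.I w.1 = w.1.im :=
    (innerSL_complex_apply _ _).trans (by simp)
  rw [map_add, map_smul, _root_.add_apply, _root_.smul_apply]
  simp only [halfPlaneWarp, prodBilin_apply, e, e2, map_zero, _root_.zero_apply, smul_eq_mul,
    Complex.zero_im]
  ring

variable [FiniteDimensional ℝ F]

omit [FiniteDimensional ℝ E] [FiniteDimensional ℝ F] in
theorem differentiableAt_prodJ (hz : z ∈ s) : DifferentiableAt ℝ (halfPlaneProdJ J) z := by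
  have h1 : DifferentiableAt ℝ (fun z : ℂ × E => J z.2) z :=
    (H.source.differentiableAt_J (H.snd_mem z hz)).comp z differentiableAt_snd
  exact ((contDiff_prodMap (V := ℂ) (W := E)).differentiable (by simp)).differentiableAt.comp z
    ((differentiableAt_const (Complex.I • ContinuousLinearMap.id ℝ ℂ : ℂ →L[ℝ] ℂ)).prodMk h1)

omit [FiniteDimensional ℝ E] [FiniteDimensional ℝ F] in
theorem prodJ_prodJ (hz : z ∈ s) (v : ℂ × E) :
    halfPlaneProdJ J z (halfPlaneProdJ J z v) = -v :=
  Prod.ext (I_smul_I_smul v.1) (H.source.J_J _ (H.snd_mem z hz) v.2)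

omit [FiniteDimensional ℝ E] [FiniteDimensional ℝ F] in
theorem fderiv_prodJ (hz : z ∈ s) (u v : ℂ × E) :
    fderiv ℝ (halfPlaneProdJ J) z u v = (0, fderiv ℝ J z.2 u.2 v.2) := by
  have hJ := H.source.differentiableAt_J (H.snd_mem z hz)
  have h1 : HasFDerivAt (fun y : ℂ × E => J y.2 v.2)
      (((fderiv ℝ J z.2).flip v.2).comp (ContinuousLinearMap.snd ℝ ℂ E)) z := by
    have h0 : HasFDerivAt (fun y => J y v.2) ((fderiv ℝ J z.2).flip v.2) z.2 := by
      have := hJ.hasFDerivAt.clm_apply (hasFDerivAt_const v.2 z.2)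
      convert this using 1
      ext; simp
    exact h0.comp z hasFDerivAt_snd
  rw [← fderiv_apply_const (H.differentiableAt_prodJ hz)]
  have h2 := (hasFDerivAt_const (Complex.I • v.1) z).prodMk h1
  have e : (fun y => halfPlaneProdJ J y v) = fun y : ℂ × E => (Complex.I • v.1, J y.2 v.2) := rfl
  rw [e, h2.fderiv]
  simp

omit [FiniteDimensional ℝ E] in
-- The product complex structure has zero derivative on plane vectors, so `J_pullbackHessL_add`
-- gives J' applied to this sum as zero, and J' is injective.
theorem hess_fst (hz : z ∈ s) : pullbackHessL h φ z (1, 0) (1, 0)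
    + pullbackHessL h φ z (Complex.I, 0) (Complex.I, 0) = 0 := by
  have h1 := H.target.J_pullbackHessL_add (H.contDiffAt hz) (H.map_mem z hz)
    (H.target_symplectic _ (H.map_mem z hz)) (H.differentiableAt_prodJ hz) (H.prodJ_prodJ hz)
    (Filter.eventually_of_mem (H.mem_nhds hz) H.holomorphic) (1, 0)
  have e : halfPlaneProdJ J z (1, 0) = (Complex.I, 0) :=
    Prod.ext (by simp [halfPlaneProdJ]) (by simp [halfPlaneProdJ])
  rw [e, H.fderiv_prodJ hz, H.fderiv_prodJ hz] at h1
  simp only [map_zero, Prod.mk_zero_zero, add_zero] at h1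
  rw [← neg_eq_zero, ← H.target.J_J _ (H.map_mem z hz), h1, map_zero]

/-- The second fundamental form of the restriction of `φ` to the fibre through `z`, as a function of
the point `y` at which the derivatives of `φ` are taken. -/
def _root_.fibreHessL (h : F → F →L[ℝ] F →L[ℝ] ℝ) (k : E → E →L[ℝ] E →L[ℝ] ℝ) (φ : ℂ × E → F)
    (y : ℂ × E) (x : E) : E →L[ℝ] E →L[ℝ] F :=
  (pullbackHessL h φ y).bilinearComp (ContinuousLinearMap.inr ℝ ℂ E)
      (ContinuousLinearMap.inr ℝ ℂ E) -
    (ContinuousLinearMap.compL ℝ E E F ((fderiv ℝ φ y).comp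
      (ContinuousLinearMap.inr ℝ ℂ E))).comp (christoffelL k x)

omit H [FiniteDimensional ℝ E] [FiniteDimensional ℝ F] in
theorem _root_.fibreHessL_apply (y : ℂ × E) (x u v : E) : fibreHessL h k φ y x u v =
    pullbackHessL h φ y (0, u) (0, v) - fderiv ℝ φ y (0, christoffel k x u v) := rfl

/-- Harmonicity of the restriction of `φ` to the fibre with metric `k`: the second fundamental form
of the restriction is opposite on v and Jv, so `metricTrace_eq_zero` applies. -/
theorem trace_fibreHessL (hz : z ∈ s) :
    metricTrace (k z.2) (fun u v => fibreHessL h k φ z z.2 u v) = 0 := by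
  have hr := H.snd_mem z hz
  have hk := H.source.toIsRiemannianMetricOn
  refine metricTrace_eq_zero (hk.isInvertible hr) (J z.2)
    (H.source.J_J _ hr) (H.source.inner_J_J _ hr) _ (fun u v => ?_) fun v => ?_
  · rw [fibreHessL_apply, fibreHessL_apply, pullbackHessL_symm H.target.toIsRiemannianMetricOn
      (H.contDiffAt hz) (H.map_mem z hz), hk.christoffel_symm hr]
  · have h1 := H.target.J_pullbackHessL_add (H.contDiffAt hz) (H.map_mem z hz)
      (H.target_symplectic _ (H.map_mem z hz)) (H.differentiableAt_prodJ hz) (H.prodJ_prodJ hz)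
      (Filter.eventually_of_mem (H.mem_nhds hz) H.holomorphic) (0, v)
    have e : ∀ w, halfPlaneProdJ J z (0, w) = (0, J z.2 w) := fun w =>
      Prod.ext (by simp [halfPlaneProdJ]) (by simp [halfPlaneProdJ])
    have e2 := H.source.covDerivJ_add hr (H.source_symplectic _ hr) v v
    simp only [covDerivJ, ← christoffelL_apply, H.source.J_J _ hr, map_neg] at e2
    simp only [christoffelL_apply] at e2
    rw [hk.christoffel_symm hr (J z.2 v) v] at e2
    -- The cancellation of ∇J on the fibre itself trades the derivatives of `J` for Christoffel
    -- symbols of `k`, which are exactly those subtracted in `fibreHessL`.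
    have e3 : fderiv ℝ J z.2 v v + fderiv ℝ J z.2 (J z.2 v) (J z.2 v) =
        J z.2 (christoffel k z.2 v v + christoffel k z.2 (J z.2 v) (J z.2 v)) := by
      rw [map_add, ← sub_eq_zero, ← e2]
      abel
    rw [e, H.fderiv_prodJ hz, H.fderiv_prodJ hz, Prod.mk_add_mk, e3, add_zero, ← e (_ + _),
      H.holomorphic z hz] at h1
    have inj : ∀ a b, J' (φ z) a = J' (φ z) b → a = b := fun a b hab => by
      rw [← neg_inj, ← H.target.J_J _ (H.map_mem z hz), hab, H.target.J_J _ (H.map_mem z hz)]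
    have h2 := inj _ _ h1
    have e4 : ((0 : ℂ), christoffel k z.2 v v + christoffel k z.2 (J z.2 v) (J z.2 v)) =
      (0, christoffel k z.2 v v) + (0, christoffel k z.2 (J z.2 v) (J z.2 v)) := by simp
    rw [e4, map_add] at h2
    rw [fibreHessL_apply, fibreHessL_apply, sub_add_sub_comm, h2, sub_self]

omit [FiniteDimensional ℝ F] in
theorem trace_eq (hz : z ∈ s) (B : ℂ × E →L[ℝ] ℂ × E →L[ℝ] F) :
    metricTrace (g z) (fun u v => B u v) = B (1, 0) (1, 0) + B (Complex.I, 0) (Complex.I, 0) +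
        (z.1.im ^ p)⁻¹ • metricTrace (k z.2) (fun u v => B (0, u) (0, v)) := by
  rw [H.metric z hz, halfPlaneWarp, metricTrace_prodBilin (H.source.pos _ (H.snd_mem z hz))
    (Real.rpow_pos_of_pos (H.im_pos z hz) p)]

omit H [FiniteDimensional ℝ F] in
theorem _root_.rpow_coefficient {x d : ℝ} (hx : 0 < x) (hd : p * d = 4) :
    (x ^ p)⁻¹ * (p * x ^ (p - 1) / 2 * d) = 2 / x := by
  have h1 : 0 < x ^ p := Real.rpow_pos_of_pos hx p
  rw [Real.rpow_sub hx, Real.rpow_one]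
  field_simp
  linarith

omit [FiniteDimensional ℝ F] in
-- The trace of `k` with respect to itself is the dimension, so the umbilicity factor of the fibres
-- contributes p · dim / (2 w₂) = 2 / w₂. This occurs once in the tension field and once more in the
-- bitension field.
theorem trace_k_smul (hz : z ∈ s) (hp : p * Module.finrank ℝ E = 4) (w : F) :
    (z.1.im ^ p)⁻¹ • metricTrace (k z.2)
      (fun u v => (p * z.1.im ^ (p - 1) / 2 * k z.2 u v) • w) = (2 / z.1.im) • w := by
  have hk := H.source.toIsRiemannianMetricOn
  have hr := H.snd_mem z hz
  have h1 := metricTrace_comp (k z.2) (fun u v => k z.2 u v)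
    ((p * z.1.im ^ (p - 1) / 2) • ContinuousLinearMap.toSpanSingleton ℝ w)
  rw [metricTrace_self (hk.isInvertible hr) (hk.symm _ hr)] at h1
  have h2 : metricTrace (k z.2) (fun u v => (p * z.1.im ^ (p - 1) / 2 * k z.2 u v) • w) =
      (p * z.1.im ^ (p - 1) / 2 * Module.finrank ℝ E) • w := by
    refine Eq.trans ?_ (h1.trans ?_)
    · congr 1
      ext u v
      simp [smul_smul]
    · simp [smul_smul]
  rw [h2, smul_smul, rpow_coefficient (H.im_pos z hz) hp]

/-- The plane part vanishes by `hess_fst` and the intrinsic fibre part by `trace_fibreHessL`,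
leaving the normal part of `christoffel_snd`. -/
theorem tension_eq (hz : z ∈ s) (hp : p * Module.finrank ℝ E = 4) :
    tension g h φ z = (2 / z.1.im) • fderiv ℝ φ z (Complex.I, 0) := by
  have e : secondFundamentalForm g h φ z = fun u v => (pullbackHessL h φ z -
      (ContinuousLinearMap.compL ℝ (ℂ × E) (ℂ × E) F (fderiv ℝ φ z)).comp (christoffelL g z)) u v := by
    ext u v
    rw [secondFundamentalForm, pullbackHessL_apply (H.contDiffAt hz)]
    rfl
  have e2 : ∀ u v, (pullbackHessL h φ z - (ContinuousLinearMap.compL ℝ (ℂ × E) (ℂ × E) F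
      (fderiv ℝ φ z)).comp (christoffelL g z)) u v =
      pullbackHessL h φ z u v - fderiv ℝ φ z (christoffel g z u v) := fun u v => rfl
  rw [tension, e, H.trace_eq hz]
  simp only [e2, H.christoffel_fst hz, H.christoffel_snd hz]
  simp only [map_zero, sub_zero, H.hess_fst hz, zero_add, map_add, map_smul]
  have e3 : (fun u v : E => pullbackHessL h φ z (0, u) (0, v) -
      (-(p * z.1.im ^ (p - 1) / 2 * k z.2 u v) • fderiv ℝ φ z (Complex.I, 0) +
        fderiv ℝ φ z (0, christoffel k z.2 u v))) = fun u v => fibreHessL h k φ z z.2 u v +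
      (p * z.1.im ^ (p - 1) / 2 * k z.2 u v) • fderiv ℝ φ z (Complex.I, 0) := by
    ext u v
    rw [fibreHessL_apply, neg_smul]
    abel
  rw [e3, metricTrace_add, H.trace_fibreHessL hz, zero_add, H.trace_k_smul hz hp]

end IsWarpedHolomorphicOn

end Warped

/-! ### The bitension field of a holomorphic map from the warped product -/

section Bitension

variable {E : Type*} [NormedAddCommGroup E] [NormedSpace ℝ E]
  {F : Type*} [NormedAddCommGroup F] [NormedSpace ℝ F] [FiniteDimensional ℝ F]
  {h : F → F →L[ℝ] F →L[ℝ] ℝ} {t : Set F}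

theorem contDiffAt_pullbackHessL {φ : E → F} {x : E} (hh : IsRiemannianMetricOn h t)
    (hφ : ContDiffAt ℝ ∞ φ x) (hx : φ x ∈ t) : ContDiffAt ℝ ∞ (pullbackHessL h φ) x := by
  have h1 := contDiffAt_fderiv hφ
  have h2 := hh.contDiffAt_christoffel_comp hφ hx
  have h3 : ContDiffAt ℝ ∞ (fun y => ((ContinuousLinearMap.compL ℝ E F F).flip (fderiv ℝ φ y)).comp
      ((christoffelL h (φ y)).comp (fderiv ℝ φ y))) x :=
    (((ContinuousLinearMap.compL ℝ E F F).flip.contDiff.contDiffAt).comp x h1).clm_comp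
      (h2.clm_comp h1)
  exact (contDiffAt_fderiv h1).add h3

/-- Commute ∇_u and ∇_w on the section dφ(v), and use ∇_v dφ(w) = ∇_w dφ(v). This absorbs the
curvature term of the bitension field into a derivative along `w`, applied with w = ∂/∂w₂. -/
theorem pullbackDeriv_pullbackHessL_add_curvature {φ : E → F} {x : E} (hh : IsRiemannianMetricOn h t)
    (hφ : ∀ᶠ y in nhds x, ContDiffAt ℝ ∞ φ y ∧ φ y ∈ t) (u v w : E) :
    pullbackDeriv h φ (fun y => pullbackHessL h φ y v w) x u
      + curvature h (φ x) (fderiv ℝ φ x w) (fderiv ℝ φ x u) (fderiv ℝ φ x v) =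
      pullbackDeriv h φ (fun y => pullbackHessL h φ y u v) x w := by
  obtain ⟨h1, hx⟩ := hφ.self_of_nhds
  have h2 := hh.pullbackDeriv_comm h1 (contDiffAt_fderiv_apply h1 v) hx u w
  have h3 : pullbackDeriv h φ (fun y => pullbackDeriv h φ (fun y => fderiv ℝ φ y v) y w) x u =
      pullbackDeriv h φ (fun y => pullbackHessL h φ y v w) x u := by
    refine pullbackDeriv_congr (hφ.mono fun y hy => ?_) u
    simp only [pullbackHessL_apply hy.1, pullbackHessL_symm hh hy.1 hy.2]
  have h4 : pullbackDeriv h φ (fun y => pullbackDeriv h φ (fun y => fderiv ℝ φ y v) y u) x w =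
      pullbackDeriv h φ (fun y => pullbackHessL h φ y u v) x w := by
    refine pullbackDeriv_congr (hφ.mono fun y hy => ?_) w
    simp only [pullbackHessL_apply hy.1]
  rw [h3, h4] at h2
  have h5 : ∀ a b c : F, curvature h (φ x) a b c = -curvature h (φ x) b a c := fun a b c => by
    simp only [curvature]; abel
  rw [h5, ← h2]
  abel

theorem IsRiemannianMetricOn.curvature_smul (hh : IsRiemannianMetricOn h t) {y : F} (hy : y ∈ t)
    (c : ℝ) (u v w : F) : curvature h y (c • u) v w = c • curvature h y u v w := by
  have dΓ := (hh.contDiffAt_christoffelL hy).differentiableAt (by simp)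
  simp only [curvature, ← christoffelL_apply, map_smul, _root_.smul_apply]
  rw [fderiv_fun_const_smul ((dΓ.clm_apply (differentiableAt_const u)).clm_apply
    (differentiableAt_const w))]
  simp only [_root_.smul_apply]
  module

omit [FiniteDimensional ℝ F] in
theorem pullbackDeriv_sum {φ : E → F} {x : E} {ι : Type*} (I : Finset ι) (V : ι → E → F)
    (hV : ∀ i ∈ I, DifferentiableAt ℝ (V i) x) (u : E) :
    pullbackDeriv h φ (fun y => ∑ i ∈ I, V i y) x u = ∑ i ∈ I, pullbackDeriv h φ (V i) x u := by
  simp only [pullbackDeriv, ← christoffelL_apply]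
  rw [fderiv_fun_sum hV]
  simp [Finset.sum_add_distrib]

omit [FiniteDimensional ℝ F] in
theorem pullbackDeriv_sub {φ V W : E → F} {x : E} (hV : DifferentiableAt ℝ V x)
    (hW : DifferentiableAt ℝ W x) (u : E) : pullbackDeriv h φ (fun y => V y - W y) x u =
      pullbackDeriv h φ V x u - pullbackDeriv h φ W x u := by
  simp only [pullbackDeriv, ← christoffelL_apply]
  rw [fderiv_fun_sub hV hW]
  simp
  abel

omit [FiniteDimensional ℝ F] in
/-- A section which vanishes along a line has zero derivative in the direction of the line. -/
theorem pullbackDeriv_eq_zero_of_line {φ V : E → F} {x u : E} (hV : DifferentiableAt ℝ V x)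
    (h0 : ∀ᶠ c : ℝ in nhds 0, V (x + c • u) = 0) : pullbackDeriv h φ V x u = 0 := by
  have h1 : V x = 0 := by simpa using h0.self_of_nhds
  have h2 : fderiv ℝ V x u = 0 := by
    rw [← hV.lineDeriv_eq_fderiv, lineDeriv, Filter.EventuallyEq.deriv_eq h0]
    simp
  rw [pullbackDeriv, h1, h2, ← christoffelL_apply]
  simp

omit [FiniteDimensional ℝ F] in
theorem hasFDerivAt_const_div_im_pow (c : ℝ) (m : ℕ) {z : ℂ × E} (hz : 0 < z.1.im) :
    HasFDerivAt (fun y : ℂ × E => c / y.1.im ^ m)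
      ((-(m * c / z.1.im ^ (m + 1))) • Complex.imCLM.comp (ContinuousLinearMap.fst ℝ ℂ E)) z := by
  have h1 : HasFDerivAt (fun y : ℂ × E => y.1.im)
      (Complex.imCLM.comp (ContinuousLinearMap.fst ℝ ℂ E)) z :=
    (Complex.imCLM.comp (ContinuousLinearMap.fst ℝ ℂ E)).hasFDerivAt
  have h2 : HasDerivAt (fun x : ℝ => c / x ^ m) (-(m * c / z.1.im ^ (m + 1))) z.1.im := by
    have h3 := (hasDerivAt_const z.1.im c).div (hasDerivAt_pow m z.1.im) (pow_ne_zero _ hz.ne')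
    refine h3.congr_deriv ?_
    -- The power rule produces the truncated exponent m - 1, so m = 0 is separated.
    rcases m with _ | m
    · simp
    · have := hz.ne'
      field_simp
      push_cast
      ring
  exact HasDerivAt.comp_hasFDerivAt (h₂ := fun x : ℝ => c / x ^ m)
    (f := fun y : ℂ × E => y.1.im) z h2 h1

/-! ### Second covariant derivatives of the tension field and their trace -/

namespace IsWarpedHolomorphicOn

variable {p : ℝ} {g : ℂ × E → ℂ × E →L[ℝ] ℂ × E →L[ℝ] ℝ}
    {k : E → E →L[ℝ] E →L[ℝ] ℝ} {J : E → E →L[ℝ] E} {r : Set E}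
    {J' : F → F →L[ℝ] F}
    {φ : ℂ × E → F} {s : Set (ℂ × E)} {z : ℂ × E}
    (H : IsWarpedHolomorphicOn p g k J r h J' t φ s)

/-- The vector field `(2 / w₂) dφ(∂ / ∂w₂)` along `φ`. -/
def _root_.radialField (φ : ℂ × E → F) (y : ℂ × E) : F :=
  (2 / y.1.im) • fderiv ℝ φ y (Complex.I, 0)

include H

omit [FiniteDimensional ℝ F] in
theorem eventually_smooth (hz : z ∈ s) : ∀ᶠ y in nhds z, ContDiffAt ℝ ∞ φ y ∧ φ y ∈ t :=
  Filter.eventually_of_mem (H.mem_nhds hz) fun y hy => ⟨H.contDiffAt hy, H.map_mem y hy⟩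

theorem differentiableAt_hess (hz : z ∈ s) : DifferentiableAt ℝ (pullbackHessL h φ) z :=
  (contDiffAt_pullbackHessL H.target.toIsRiemannianMetricOn (H.contDiffAt hz)
    (H.map_mem z hz)).differentiableAt (by simp)

theorem differentiableAt_hess_apply (hz : z ∈ s) (u v : ℂ × E) :
    DifferentiableAt ℝ (fun y => pullbackHessL h φ y u v) z :=
  ((H.differentiableAt_hess hz).clm_apply (differentiableAt_const u)).clm_apply
    (differentiableAt_const v)

omit [FiniteDimensional ℝ F] in
theorem differentiableAt_dφ (hz : z ∈ s) (v : ℂ × E) :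
    DifferentiableAt ℝ (fun y => fderiv ℝ φ y v) z :=
  (contDiffAt_fderiv_apply (H.contDiffAt hz) v).differentiableAt (by simp)

omit [FiniteDimensional ℝ F] in
theorem pullbackDeriv_radialField (hz : z ∈ s) (v : ℂ × E) :
    pullbackDeriv h φ (radialField φ) z v =
      (-2 / z.1.im ^ 2 * v.1.im) • fderiv ℝ φ z (Complex.I, 0)
        + (2 / z.1.im) • pullbackHessL h φ z v (Complex.I, 0) := by
  have h1 := hasFDerivAt_const_div_im_pow (E := E) 2 1 (H.im_pos z hz)
  simp only [pow_one] at h1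
  unfold radialField
  rw [pullbackDeriv_smul h1.differentiableAt (H.differentiableAt_dφ hz _), h1.fderiv,
    pullbackHessL_apply (H.contDiffAt hz)]
  congr 2
  simp
  ring

theorem pullbackDeriv_pullbackDeriv_radialField (hz : z ∈ s) (u v : ℂ × E) :
    pullbackDeriv h φ (fun y => pullbackDeriv h φ (radialField φ) y v) z u =
      (4 / z.1.im ^ 3 * u.1.im * v.1.im) • fderiv ℝ φ z (Complex.I, 0)
      - (2 / z.1.im ^ 2) • (v.1.im • pullbackHessL h φ z u (Complex.I, 0)
        + u.1.im • pullbackHessL h φ z v (Complex.I, 0))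
      + (2 / z.1.im) • pullbackDeriv h φ
        (fun y => pullbackHessL h φ y v (Complex.I, 0)) z u := by
  have h1 := hasFDerivAt_const_div_im_pow (E := E) 2 1 (H.im_pos z hz)
  have h2 := (hasFDerivAt_const_div_im_pow (E := E) (-2) 2 (H.im_pos z hz)).mul_const v.1.im
  simp only [pow_one] at h1
  have e : pullbackDeriv h φ (fun y => pullbackDeriv h φ (radialField φ) y v) z u =
      pullbackDeriv h φ (fun y => (-2 / y.1.im ^ 2 * v.1.im) • fderiv ℝ φ y (Complex.I, 0)
        + (2 / y.1.im) • pullbackHessL h φ y v (Complex.I, 0)) z u :=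
    pullbackDeriv_congr (Filter.eventuallyEq_of_mem (H.mem_nhds hz)
      fun y hy => H.pullbackDeriv_radialField hy v) u
  have d1 := H.differentiableAt_dφ hz (Complex.I, 0)
  have d2 := H.differentiableAt_hess_apply hz v (Complex.I, 0)
  rw [e, pullbackDeriv_add (h2.differentiableAt.fun_smul d1) (h1.differentiableAt.fun_smul d2),
    pullbackDeriv_smul h2.differentiableAt d1, pullbackDeriv_smul h1.differentiableAt d2,
    h1.fderiv, h2.fderiv, pullbackHessL_apply (H.contDiffAt hz)]
  simp only [_root_.smul_apply, ContinuousLinearMap.comp_apply, Complex.imCLM_apply,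
    ContinuousLinearMap.coe_fst', smul_eq_mul]
  push_cast
  norm_num
  module

/-- The bilinear map whose trace is the bitension field. -/
def _root_.bitensionL (g : ℂ × E → ℂ × E →L[ℝ] ℂ × E →L[ℝ] ℝ) (h : F → F →L[ℝ] F →L[ℝ] ℝ)
    (φ : ℂ × E → F) (z : ℂ × E) : ℂ × E →L[ℝ] ℂ × E →L[ℝ] F :=
  let l : ℂ × E →L[ℝ] ℝ := Complex.imCLM.comp (ContinuousLinearMap.fst ℝ ℂ E)
  let N : ℂ × E →L[ℝ] F := (pullbackHessL h φ z).flip (Complex.I, 0)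
  (4 / z.1.im ^ 3) • l.smulRight (l.smulRight (fderiv ℝ φ z (Complex.I, 0)))
    - (2 / z.1.im ^ 2) • ((ContinuousLinearMap.smulRightL ℝ (ℂ × E) F l).comp N + l.smulRight N)
    + (2 / z.1.im) • (fderiv ℝ (pullbackHessL h φ) z (Complex.I, 0) +
      (ContinuousLinearMap.compL ℝ (ℂ × E) F F (christoffelL h (φ z)
        (fderiv ℝ φ z (Complex.I, 0)))).comp (pullbackHessL h φ z))
    - (ContinuousLinearMap.compL ℝ (ℂ × E) (ℂ × E) F
        (pullbackDerivL h φ (radialField φ) z)).comp (christoffelL g z)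

theorem bitensionL_apply (hz : z ∈ s) (u v : ℂ × E) : bitensionL g h φ z u v =
    (4 / z.1.im ^ 3) • u.1.im • v.1.im • fderiv ℝ φ z (Complex.I, 0)
      - (2 / z.1.im ^ 2) • (v.1.im • pullbackHessL h φ z u (Complex.I, 0)
        + u.1.im • pullbackHessL h φ z v (Complex.I, 0))
      + (2 / z.1.im) • pullbackDeriv h φ (fun y => pullbackHessL h φ y u v) z (Complex.I, 0)
      - pullbackDeriv h φ (radialField φ) z (christoffel g z u v) := by
  have d := H.differentiableAt_hess hz
  rw [pullbackDeriv, fderiv_apply_const (d.clm_apply (differentiableAt_const u)),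
    fderiv_apply_const d]
  rfl

variable [FiniteDimensional ℝ E]

/-- The two sides agree for each pair u, v before tracing. The curvature term has been absorbed by
commuting derivatives, so what is traced is visibly bilinear and `trace_eq` becomes available. -/
theorem bitension_eq_trace (hz : z ∈ s) (hp : p * Module.finrank ℝ E = 4) :
    bitension g h φ z = metricTrace (g z) (fun u v => bitensionL g h φ z u v) := by
  have hh := H.target.toIsRiemannianMetricOn
  have e : tension g h φ =ᶠ[nhds z] radialField φ :=
    Filter.eventuallyEq_of_mem (H.mem_nhds hz) fun y hy => H.tension_eq hy hp
  rw [bitension, ← metricTrace_add]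
  congr 1
  ext u v
  have e1 : pullbackDeriv h φ (fun y => pullbackDeriv h φ (tension g h φ) y v) z u =
      pullbackDeriv h φ (fun y => pullbackDeriv h φ (radialField φ) y v) z u := by
    refine pullbackDeriv_congr ?_ u
    -- Two derivatives are taken, so the formula for the tension field is needed in a neighbourhood
    -- of every nearby point.
    filter_upwards [e.eventuallyEq_nhds] with y hy using pullbackDeriv_congr hy v
  rw [H.bitensionL_apply hz, pullbackDeriv₂, e1, pullbackDeriv_congr e, e.eq_of_nhds,
    H.pullbackDeriv_pullbackDeriv_radialField hz, radialField,
    hh.curvature_smul (H.map_mem z hz),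
    ← pullbackDeriv_pullbackHessL_add_curvature hh (H.eventually_smooth hz) u v (Complex.I, 0)]
  module

omit [FiniteDimensional ℝ E] in
theorem pullbackDeriv_hess_fst (hz : z ∈ s) :
    pullbackDeriv h φ (fun y => pullbackHessL h φ y (1, 0) (1, 0)) z (Complex.I, 0) +
      pullbackDeriv h φ (fun y => pullbackHessL h φ y (Complex.I, 0) (Complex.I, 0)) z
        (Complex.I, 0) = 0 := by
  rw [← pullbackDeriv_add (H.differentiableAt_hess_apply hz _ _)
    (H.differentiableAt_hess_apply hz _ _)]
  have e : (fun y => pullbackHessL h φ y (1, 0) (1, 0)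
      + pullbackHessL h φ y (Complex.I, 0) (Complex.I, 0)) =ᶠ[nhds z] fun _ => 0 :=
    Filter.eventuallyEq_of_mem (H.mem_nhds hz) fun y hy => H.hess_fst hy
  rw [pullbackDeriv_congr e, pullbackDeriv, ← christoffelL_apply]
  simp

/-- With the fibre metric and connection frozen at `z.2`, the trace is known to vanish at points
over `z.2`. The line through `z` in direction ∂/∂w₂ stays over `z.2`, and vanishing along that line
is enough for a derivative in its direction. -/
theorem trace_pullbackDeriv_fibreHessL (hz : z ∈ s) :
    metricTrace (k z.2) (fun u v => pullbackDeriv h φ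
      (fun y => fibreHessL h k φ y z.2 u v) z (Complex.I, 0)) = 0 := by
  have hd : ∀ u v : E, DifferentiableAt ℝ (fun y => fibreHessL h k φ y z.2 u v) z := fun u v =>
    (H.differentiableAt_hess_apply hz _ _).sub (H.differentiableAt_dφ hz _)
  unfold metricTrace
  rw [← pullbackDeriv_sum _ _ fun i _ => hd _ _]
  refine pullbackDeriv_eq_zero_of_line (DifferentiableAt.fun_sum fun i _ => hd _ _) ?_
  have hc : Filter.Tendsto (fun c : ℝ => z + c • ((Complex.I, 0) : ℂ × E)) (nhds 0) (nhds z) := by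
    have : Continuous (fun c : ℝ => z + c • ((Complex.I, 0) : ℂ × E)) := by fun_prop
    simpa using this.tendsto 0
  filter_upwards [hc.eventually (H.mem_nhds hz)] with c hc
  have h2 : (z + c • ((Complex.I, 0) : ℂ × E)).2 = z.2 := by simp
  have h3 := H.trace_fibreHessL hc
  rw [h2] at h3
  exact h3

/-- With f(y) = 2 / y, the plane contributes f'' dφ(∂) + 2f' ∇_∂ dφ(∂), and the bending of the
fibres contributes f ∇_∂(f dφ(∂)). The sum vanishes because f f' = -f'' and f² = -2f'. -/
theorem bitension_eq_zero (hz : z ∈ s) (hp : p * Module.finrank ℝ E = 4) :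
    bitension g h φ z = 0 := by
  have hh := H.target.toIsRiemannianMetricOn
  have him := H.im_pos z hz
  -- On fibre vectors the im-terms drop out. The tangential Christoffel part contributes f ∇_∂
  -- dφ(Γ_k(u, v)), by symmetry of the Hessian, and completes the Hessian to `fibreHessL` with
  -- frozen base point.
  have e : (fun u v : E => bitensionL g h φ z (0, u) (0, v)) = fun u v =>
      (2 / z.1.im) • pullbackDeriv h φ (fun y => fibreHessL h k φ y z.2 u v) z (Complex.I, 0)
      + (p * z.1.im ^ (p - 1) / 2 * k z.2 u v) •
        pullbackDeriv h φ (radialField φ) z (Complex.I, 0) := by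
    ext u v
    simp only [H.bitensionL_apply hz, H.christoffel_snd hz, fibreHessL_apply]
    rw [pullbackDeriv_sub (H.differentiableAt_hess_apply hz _ _) (H.differentiableAt_dφ hz _),
      pullbackHessL_apply (H.contDiffAt hz), pullbackHessL_symm hh (H.contDiffAt hz)
      (H.map_mem z hz) (Complex.I, 0), pullbackDeriv_dir_add, pullbackDeriv_dir_smul,
      H.pullbackDeriv_radialField hz (0, _)]
    simp
    module
  rw [H.bitension_eq_trace hz hp, H.trace_eq hz, e, metricTrace_add, metricTrace_smul,
    H.trace_pullbackDeriv_fibreHessL hz, smul_zero, zero_add, H.trace_k_smul hz hp,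
    H.bitensionL_apply hz, H.bitensionL_apply hz, H.christoffel_fst hz, H.christoffel_fst hz,
    H.pullbackDeriv_radialField hz, H.pullbackDeriv_radialField hz]
  have h1 := H.pullbackDeriv_hess_fst hz
  rw [eq_neg_of_add_eq_zero_left h1]
  simp
  -- `h3` is f f' = -f'' and `h4` is f² = -2f' for f(y) = 2 / y.
  have h3 : (2 / z.1.im) * (-2 / z.1.im ^ 2) = -(4 / z.1.im ^ 3) := by field_simp; norm_num
  have h4 : (2 / z.1.im) * (2 / z.1.im) = 2 / z.1.im ^ 2 + 2 / z.1.im ^ 2 := by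
    field_simp; norm_num
  simp only [smul_smul, h3, h4]
  module

end IsWarpedHolomorphicOn

end Bitension

/-! ### Almost Hermitian structures in charts -/

section Charts

variable {E : Type*} [NormedAddCommGroup E] [NormedSpace ℝ E]
  {H : Type*} [TopologicalSpace H] {I : ModelWithCorners ℝ E H} [I.Boundaryless]
  {M : Type*} [TopologicalSpace M] [ChartedSpace H M] [IsManifold I ∞ M]
  {e : OpenPartialHomeomorph M H} {x : E}

variable (I) in
/-- The derivative of the inverse of the chart `e`. -/
def chartSymmDeriv (e : OpenPartialHomeomorph M H) (x : E) : E →L[ℝ] E :=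
  mfderiv 𝓘(ℝ, E) I (e.extend I).symm x

variable (I) in
/-- The derivative of the chart `e`. -/
def chartDeriv (e : OpenPartialHomeomorph M H) (p : M) : E →L[ℝ] E :=
  mfderiv I 𝓘(ℝ, E) (e.extend I) p

omit [ChartedSpace H M] [IsManifold I ∞ M] in
theorem target_mem_nhds (hx : x ∈ (e.extend I).target) : (e.extend I).target ∈ nhds x :=
  (e.isOpen_extend_target (I := I)).mem_nhds hx

theorem contMDiffAt_extend_symm (he : e ∈ atlas H M) (hx : x ∈ (e.extend I).target) :
    ContMDiffAt 𝓘(ℝ, E) I ∞ (e.extend I).symm x := by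
  have h := contMDiffOn_extend_symm (I := I) (n := ∞) (IsManifold.subset_maximalAtlas he)
  rw [← e.extend_target'] at h
  exact h.contMDiffAt (target_mem_nhds hx)

omit [I.Boundaryless] in
theorem contMDiffAt_extend_of_mem (he : e ∈ atlas H M) {p : M} (hp : p ∈ e.source) :
    ContMDiffAt I 𝓘(ℝ, E) ∞ (e.extend I) p :=
  (OpenPartialHomeomorph.contMDiffOn_extend (I := I) (n := ∞)
    (IsManifold.subset_maximalAtlas he)).contMDiffAt (e.open_source.mem_nhds hp)

omit [I.Boundaryless] [ChartedSpace H M] [IsManifold I ∞ M] in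
theorem symm_mem_source (hx : x ∈ (e.extend I).target) : (e.extend I).symm x ∈ e.source := by
  rw [← e.extend_source (I := I)]
  exact (e.extend I).map_target hx

theorem chartDeriv_chartSymmDeriv (he : e ∈ atlas H M) (hx : x ∈ (e.extend I).target) (v : E) :
    chartDeriv I e ((e.extend I).symm x) (chartSymmDeriv I e x v) = v := by
  have h1 := (contMDiffAt_extend_symm he hx).mdifferentiableAt (by simp)
  have h2 := (contMDiffAt_extend_of_mem (I := I) he (symm_mem_source hx)).mdifferentiableAt (by simp)
  have h3 := mfderiv_comp x h2 h1
  have h4 : (e.extend I) ∘ (e.extend I).symm =ᶠ[nhds x] id :=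
    Filter.eventuallyEq_of_mem (target_mem_nhds hx) fun y hy => (e.extend I).right_inv hy
  rw [h4.mfderiv_eq, mfderiv_id] at h3
  exact (congrArg (fun A : E →L[ℝ] E => A v) h3).symm

theorem chartSymmDeriv_chartDeriv (he : e ∈ atlas H M) (hx : x ∈ (e.extend I).target) (v : E) :
    chartSymmDeriv I e x (chartDeriv I e ((e.extend I).symm x) v) = v := by
  have hp : (e.extend I).symm x ∈ e.source := symm_mem_source hx
  have hx' : (e.extend I) ((e.extend I).symm x) = x := (e.extend I).right_inv hx
  have h1 := (contMDiffAt_extend_symm he hx).mdifferentiableAt (by simp)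
  have h2 := (contMDiffAt_extend_of_mem (I := I) he hp).mdifferentiableAt (by simp)
  have h3 := mfderiv_comp_of_eq h1 h2 hx'
  have h4 : (e.extend I).symm ∘ (e.extend I) =ᶠ[nhds ((e.extend I).symm x)] id :=
    Filter.eventuallyEq_of_mem (e.open_source.mem_nhds hp) fun y hy =>
      (e.extend I).left_inv (by rwa [e.extend_source])
  rw [h4.mfderiv_eq, mfderiv_id] at h3
  have h5 := (congrArg (fun A : E →L[ℝ] E => A v) h3).symm
  have h6 : chartSymmDeriv I e (e.extend I ((e.extend I).symm x))
      (chartDeriv I e ((e.extend I).symm x) v) = v := h5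
  rwa [hx'] at h6

theorem chartSymmDeriv_eq_fderiv (he : e ∈ atlas H M) (hx : x ∈ (e.extend I).target) :
    chartSymmDeriv I e x =
      fderiv ℝ (extChartAt I ((e.extend I).symm x) ∘ (e.extend I).symm) x := by
  have h1 := (contMDiffAt_extend_symm he hx).mdifferentiableAt (by simp)
  refine h1.mfderiv.trans ?_
  simp only [writtenInExtChartAt, ModelWithCorners.range_eq_univ, fderivWithin_univ]
  rfl

/-- The tangent space at a point is read in the preferred chart of that point, which may jump.
Factoring through the chart at a fixed `p` isolates the jump in `tangentCoordChange`, matching the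
local form of smoothness of bundle sections. -/
theorem tangentCoordChange_comp_fderiv (he : e ∈ atlas H M) (hx : x ∈ (e.extend I).target) {p : M}
    (hp : (e.extend I).symm x ∈ (chartAt H p).source) :
    (tangentCoordChange I p ((e.extend I).symm x) ((e.extend I).symm x)).comp
      (fderiv ℝ (extChartAt I p ∘ (e.extend I).symm) x) = chartSymmDeriv I e x := by
  set q := (e.extend I).symm x with hq
  have hp' : q ∈ (extChartAt I p).source := by rwa [extChartAt_source]
  have hcont : ContinuousAt (e.extend I).symm x := (contMDiffAt_extend_symm he hx).continuousAt
  have h1 : DifferentiableAt ℝ (extChartAt I p ∘ (e.extend I).symm) x := by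
    have : ContMDiffAt 𝓘(ℝ, E) 𝓘(ℝ, E) ∞ (extChartAt I p ∘ (e.extend I).symm) x :=
      (contMDiffAt_extChartAt' hp).comp x (contMDiffAt_extend_symm he hx)
    exact this.contDiffAt.differentiableAt (by simp)
  have h2 := hasFDerivWithinAt_tangentCoordChange (I := I) (x := p) (y := q) (z := q)
    ⟨hp', mem_extChartAt_source q⟩
  rw [I.range_eq_univ, hasFDerivWithinAt_univ] at h2
  rw [chartSymmDeriv_eq_fderiv he hx]
  have h3 := HasFDerivAt.comp (f := extChartAt I p ∘ (e.extend I).symm) x h2 h1.hasFDerivAt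
  rw [← h3.fderiv]
  refine Filter.EventuallyEq.fderiv_eq ?_
  have h5 : (e.extend I).symm ⁻¹' (extChartAt I p).source ∈ nhds x :=
    hcont.preimage_mem_nhds (extChartAt_source_mem_nhds' hp')
  filter_upwards [h5] with y hy
  exact congrArg (extChartAt I q) ((extChartAt I p).left_inv hy)

theorem contDiffAt_extChartAt_symm (he : e ∈ atlas H M) (hx : x ∈ (e.extend I).target) {p : M}
    (hp : (e.extend I).symm x ∈ (chartAt H p).source) :
    ContDiffAt ℝ ∞ (extChartAt I p ∘ (e.extend I).symm) x :=
  ContMDiffAt.contDiffAt ((contMDiffAt_extChartAt' hp).comp x (contMDiffAt_extend_symm he hx))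

omit [I.Boundaryless] in
theorem coordMetric_apply (g : ContMDiffRiemannianMetric I ∞ E (fun x : M => TangentSpace I x))
    (u v : E) : coordMetric g e x u v =
      g.inner ((e.extend I).symm x) (chartSymmDeriv I e x u) (chartSymmDeriv I e x v) := rfl

/-- Near `x` the coordinate metric is the metric trivialised at the fixed point `p`, pulled back by
the smooth derivative of a transition map. -/
theorem contDiffAt_coordMetric (g : ContMDiffRiemannianMetric I ∞ E (fun x : M => TangentSpace I x))
    (he : e ∈ atlas H M) (hx : x ∈ (e.extend I).target) : ContDiffAt ℝ ∞ (coordMetric g e) x := by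
  set p := (e.extend I).symm x with hp
  have h1 := (contMDiffAt_bilin_iff g.inner p).1 (g.contMDiff p)
  have h2 := (h1.comp x (contMDiffAt_extend_symm he hx)).contDiffAt
  have h3 : ContDiffAt ℝ ∞ (fun y => fderiv ℝ (extChartAt I p ∘ (e.extend I).symm) y) x :=
    contDiffAt_fderiv (contDiffAt_extChartAt_symm he hx (mem_chart_source H p))
  have h4 := ((ContinuousLinearMap.compL ℝ E E ℝ).flip.contDiff.contDiffAt.comp x h3).clm_comp
    (h2.clm_comp h3)
  refine h4.congr_of_eventuallyEq ?_
  have hcont : ContinuousAt (e.extend I).symm x := (contMDiffAt_extend_symm he hx).continuousAt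
  filter_upwards [target_mem_nhds hx, hcont.preimage_mem_nhds (chart_source_mem_nhds H p)]
    with y hy hy'
  ext u v
  rw [coordMetric_apply, ← tangentCoordChange_comp_fderiv he hy hy']
  rfl

theorem chartSymmDeriv_coordJ (S : AlmostHermitianStructure I M) (he : e ∈ atlas H M)
    (hx : x ∈ (e.extend I).target) (v : E) : chartSymmDeriv I e x (coordJ S e x v) =
      S.J ((e.extend I).symm x) (chartSymmDeriv I e x v) :=
  chartSymmDeriv_chartDeriv he hx _

theorem chartSymmDeriv_injective (he : e ∈ atlas H M) (hx : x ∈ (e.extend I).target) :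
    Function.Injective (chartSymmDeriv I e x) :=
  Function.LeftInverse.injective (chartDeriv_chartSymmDeriv he hx)

theorem contDiffAt_coordJ [CompleteSpace E] (S : AlmostHermitianStructure I M) (he : e ∈ atlas H M)
    (hx : x ∈ (e.extend I).target) : ContDiffAt ℝ ∞ (coordJ S e) x := by
  set p := (e.extend I).symm x with hp
  have h1 := (contMDiffAt_endo_iff S.J p).1 (S.contMDiff_J p)
  have h2 := (h1.comp x (contMDiffAt_extend_symm he hx)).contDiffAt
  set A := fun y => fderiv ℝ (extChartAt I p ∘ (e.extend I).symm) y with hA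
  have h3 : ContDiffAt ℝ ∞ A x :=
    contDiffAt_fderiv (contDiffAt_extChartAt_symm he hx (mem_chart_source H p))
  -- `coordJ` is the endomorphism trivialised at `p`, conjugated by the transition derivative `A`.
  -- Knowing that `B` is the inverse of `A` lets `B` be replaced by `inverse`, whose smoothness is
  -- known.
  have key : ∀ y ∈ (e.extend I).target, (e.extend I).symm y ∈ (chartAt H p).source →
      ∃ B : E →L[ℝ] E, A y ∘L B = .id ℝ E ∧ B ∘L A y = .id ℝ E ∧ coordJ S e y =
        B.comp (((tangentCoordChange I ((e.extend I).symm y) p ((e.extend I).symm y)).comp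
          (ContinuousLinearMap.comp (M₂ := E) (S.J ((e.extend I).symm y) : E →L[ℝ] E)
        (tangentCoordChange I p ((e.extend I).symm y) ((e.extend I).symm y)))).comp (A y)) := by
    intro y hy hy'
    set q := (e.extend I).symm y with hq
    have hq' : q ∈ (extChartAt I p).source := by rwa [extChartAt_source]
    have t1 : ∀ v, tangentCoordChange I p q q (tangentCoordChange I q p q v) = v := fun v => by
      rw [tangentCoordChange_comp ⟨⟨mem_extChartAt_source q, hq'⟩, mem_extChartAt_source q⟩,
        tangentCoordChange_self (mem_extChartAt_source q)]
    have t2 : ∀ v, tangentCoordChange I q p q (tangentCoordChange I p q q v) = v := fun v => by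
      rw [tangentCoordChange_comp ⟨⟨hq', mem_extChartAt_source q⟩, hq'⟩,
        tangentCoordChange_self hq']
    have t3 : ∀ v, tangentCoordChange I p q q (A y v) = chartSymmDeriv I e y v := fun v => by
      rw [← tangentCoordChange_comp_fderiv he hy hy']
      rfl
    refine ⟨(chartDeriv I e q).comp (tangentCoordChange I p q q), ?_, ?_, ?_⟩
    · ext v
      change A y (chartDeriv I e q (tangentCoordChange I p q q v)) = v
      rw [← t2 (A y _), t3, chartSymmDeriv_chartDeriv he hy, t2]
    · ext v
      change chartDeriv I e q (tangentCoordChange I p q q (A y v)) = v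
      rw [t3, chartDeriv_chartSymmDeriv he hy]
    · ext v
      change _ = chartDeriv I e q (tangentCoordChange I p q q (tangentCoordChange I q p q
        (S.J q (tangentCoordChange I p q q (A y v)))))
      refine Eq.trans ?_ (congrArg (chartDeriv I e q) (t1 _)).symm
      exact congrArg (fun w : E => chartDeriv I e q (S.J q w)) (t3 v).symm
  have hinv : (A x).IsInvertible := by
    obtain ⟨B, hB, hB', -⟩ := key x hx (mem_chart_source H p)
    exact ContinuousLinearMap.IsInvertible.of_inverse hB hB'
  have h4 : ContDiffAt ℝ ∞ (fun y => (A y).inverse) x :=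
    (hinv.contDiffAt_map_inverse (n := ∞)).comp x h3
  refine (h4.clm_comp (h2.clm_comp h3)).congr_of_eventuallyEq ?_
  have hcont : ContinuousAt (e.extend I).symm x := (contMDiffAt_extend_symm he hx).continuousAt
  filter_upwards [target_mem_nhds hx, hcont.preimage_mem_nhds (chart_source_mem_nhds H p)]
    with y hy hy'
  obtain ⟨B, hB, hB', h⟩ := key y hy hy'
  rw [h, ContinuousLinearMap.inverse_eq hB hB']
  rfl

/-- An almost Hermitian structure, read in a chart, is an almost Hermitian structure. -/
theorem isAlmostHermitianOn_coord [CompleteSpace E] (S : AlmostHermitianStructure I M)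
    (he : e ∈ atlas H M) :
    IsAlmostHermitianOn (coordMetric S.metric e) (coordJ S e) (e.extend I).target where
  isOpen := e.isOpen_extend_target
  contDiffOn x hx := (contDiffAt_coordMetric S.metric he hx).contDiffWithinAt
  contDiffOn_J x hx := (contDiffAt_coordJ S he hx).contDiffWithinAt
  symm x hx u v := S.metric.symm _ _ _
  pos x hx v hv := S.metric.pos _ _ fun h0 => hv (chartSymmDeriv_injective he hx
    (h0.trans (map_zero (chartSymmDeriv I e x)).symm))
  J_J x hx v := chartSymmDeriv_injective he hx (by
    rw [chartSymmDeriv_coordJ S he hx, chartSymmDeriv_coordJ S he hx, map_neg]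
    exact S.J_J _ _)
  inner_J_J x hx u v := by
    rw [coordMetric_apply, coordMetric_apply, chartSymmDeriv_coordJ S he hx,
      chartSymmDeriv_coordJ S he hx]
    exact S.inner_J_J _ _ _

theorem IsOneTwoSymplecticAt.of_closed {G : E → E →L[ℝ] E →L[ℝ] ℝ} {J : E → E →L[ℝ] E}
    (h : ∀ u v w : E, dFundamentalForm G J x u v w = 0) : IsOneTwoSymplecticAt G J x := by
  intro u v w
  simp [complexExtension, h]

end Charts

/-! ### Maps in charts -/

section MapsInCharts

variable {E : Type*} [NormedAddCommGroup E] [NormedSpace ℝ E]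
  {H : Type*} [TopologicalSpace H] {I : ModelWithCorners ℝ E H} [I.Boundaryless]
  {M : Type*} [TopologicalSpace M] [ChartedSpace H M] [IsManifold I ∞ M]
  {F : Type*} [NormedAddCommGroup F] [NormedSpace ℝ F]
  {H' : Type*} [TopologicalSpace H'] {I' : ModelWithCorners ℝ F H'} [I'.Boundaryless]
  {N : Type*} [TopologicalSpace N] [ChartedSpace H' N] [IsManifold I' ∞ N]
  {e : OpenPartialHomeomorph M H} {e' : OpenPartialHomeomorph N H'} {x : E} {φ : M → N}

variable (I) in
/-- The domain of the coordinate representation of a map. -/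
def coordDomain (φ : M → N) (e : OpenPartialHomeomorph M H) (e' : OpenPartialHomeomorph N H') :
    Set E :=
  (e.extend I).target ∩ {x | φ ((e.extend I).symm x) ∈ e'.source}

omit [I'.Boundaryless] [IsManifold I ∞ M] [IsManifold I' ∞ N] in
theorem isOpen_coordDomain (hφ : ContMDiff I I' ∞ φ) : IsOpen (coordDomain I φ e e') := by
  have h1 : ContinuousOn (φ ∘ (e.extend I).symm) (e.extend I).target :=
    hφ.continuous.comp_continuousOn (e.continuousOn_extend_symm)
  exact h1.isOpen_inter_preimage e.isOpen_extend_target e'.open_source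

omit [I'.Boundaryless] in
theorem contDiffAt_coordMap (hφ : ContMDiff I I' ∞ φ) (he : e ∈ atlas H M) (he' : e' ∈ atlas H' N)
    (hx : x ∈ coordDomain I φ e e') : ContDiffAt ℝ ∞ (coordMap I I' φ e e') x := by
  have h1 := (hφ ((e.extend I).symm x)).comp x (contMDiffAt_extend_symm he hx.1)
  have h2 : ContMDiffAt 𝓘(ℝ, E) 𝓘(ℝ, F) ∞ (coordMap I I' φ e e') x :=
    ContMDiffAt.comp (g := e'.extend I') x (contMDiffAt_extend_of_mem he' hx.2) h1
  exact h2.contDiffAt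

omit [I'.Boundaryless] in
theorem fderiv_coordMap (hφ : ContMDiff I I' ∞ φ) (he : e ∈ atlas H M) (he' : e' ∈ atlas H' N)
    (hx : x ∈ coordDomain I φ e e') (v : E) : fderiv ℝ (coordMap I I' φ e e') x v =
      chartDeriv I' e' (φ ((e.extend I).symm x))
        (mfderiv I I' φ ((e.extend I).symm x) (chartSymmDeriv I e x v)) := by
  have h0 := (contMDiffAt_extend_symm he hx.1).mdifferentiableAt (by simp)
  have h1 := (hφ ((e.extend I).symm x)).mdifferentiableAt (by simp)
  have h2 := (contMDiffAt_extend_of_mem (I := I') he' hx.2).mdifferentiableAt (by simp)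
  have h3 := mfderiv_comp x h1 h0
  have h4 := mfderiv_comp (g := e'.extend I') x h2 (h1.comp x h0)
  rw [h3, mfderiv_eq_fderiv] at h4
  exact congrArg (fun A : E →L[ℝ] F => A v) h4

theorem coordJ_chartDeriv (T : AlmostHermitianStructure I M) (he : e ∈ atlas H M) {q : M}
    (hq : q ∈ e.source) (w : E) :
    coordJ T e (e.extend I q) (chartDeriv I e q w) = chartDeriv I e q (T.J q w) := by
  have hy : e.extend I q ∈ (e.extend I).target :=
    (e.extend I).map_source (by rwa [e.extend_source])
  have hq' : q = (e.extend I).symm (e.extend I q) :=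
    ((e.extend I).left_inv (by rwa [e.extend_source])).symm
  -- The point is generalised so that the equality can be substituted; rewriting it directly would
  -- change the tangent space that `w` lives in.
  have key : ∀ y ∈ (e.extend I).target, ∀ q, q = (e.extend I).symm y → ∀ w : E,
      coordJ T e y (chartDeriv I e q w) = chartDeriv I e q (T.J q w) := by
    rintro y hy q rfl w
    change chartDeriv I e _ (T.J _ (chartSymmDeriv I e y (chartDeriv I e _ w))) = _
    exact congrArg (fun w : E => chartDeriv I e ((e.extend I).symm y) (T.J _ w))
      (chartSymmDeriv_chartDeriv he hy w)
  exact key _ hy q hq' w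

theorem IsHolomorphicMap.fderiv_coordMap {S : AlmostHermitianStructure I M}
    {T : AlmostHermitianStructure I' N} (hφ : IsHolomorphicMap S T φ) (he : e ∈ atlas H M)
    (he' : e' ∈ atlas H' N) (hx : x ∈ coordDomain I φ e e') (v : E) :
    fderiv ℝ (coordMap I I' φ e e') x (coordJ S e x v) =
      coordJ T e' (coordMap I I' φ e e' x) (fderiv ℝ (coordMap I I' φ e e') x v) := by
  rw [_root_.fderiv_coordMap hφ.1 he he' hx, _root_.fderiv_coordMap hφ.1 he he' hx]
  have h1 := coordJ_chartDeriv T he' hx.2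
    (mfderiv I I' φ ((e.extend I).symm x) (chartSymmDeriv I e x v))
  refine Eq.trans ?_ h1.symm
  refine congrArg (chartDeriv I' e' (φ ((e.extend I).symm x))) ?_
  refine Eq.trans ?_ (hφ.2 _ _)
  exact congrArg (mfderiv I I' φ ((e.extend I).symm x)) (chartSymmDeriv_coordJ S he hx.1 v)

end MapsInCharts

/-! ### Charts of the warped product -/

section WarpedCharts

variable {E : Type*} [NormedAddCommGroup E] [NormedSpace ℝ E]
  {H : Type*} [TopologicalSpace H] {I : ModelWithCorners ℝ E H} [I.Boundaryless]
  {K : Type*} [TopologicalSpace K] [ChartedSpace H K] [IsManifold I ∞ K]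
  {e₁ : OpenPartialHomeomorph UpperHalfPlane ℂ} {e₂ : OpenPartialHomeomorph K H}

theorem UpperHalfPlane.extend_apply (he : e₁ ∈ atlas ℂ UpperHalfPlane) (w : UpperHalfPlane) :
    e₁.extend 𝓘(ℝ, ℂ) w = w := by
  obtain rfl : e₁ = _ := he
  rfl

theorem UpperHalfPlane.coe_extend_symm (he : e₁ ∈ atlas ℂ UpperHalfPlane) {z : ℂ}
    (hz : z ∈ (e₁.extend 𝓘(ℝ, ℂ)).target) : ((e₁.extend 𝓘(ℝ, ℂ)).symm z : ℂ) = z := by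
  have h := (e₁.extend 𝓘(ℝ, ℂ)).right_inv hz
  rwa [UpperHalfPlane.extend_apply he] at h

theorem UpperHalfPlane.chartSymmDeriv_eq (he : e₁ ∈ atlas ℂ UpperHalfPlane) {z : ℂ}
    (hz : z ∈ (e₁.extend 𝓘(ℝ, ℂ)).target) :
    chartSymmDeriv 𝓘(ℝ, ℂ) e₁ z = ContinuousLinearMap.id ℝ ℂ := by
  rw [chartSymmDeriv_eq_fderiv he hz]
  have h : extChartAt 𝓘(ℝ, ℂ) ((e₁.extend 𝓘(ℝ, ℂ)).symm z) ∘ (e₁.extend 𝓘(ℝ, ℂ)).symm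
      =ᶠ[nhds z] id :=
    Filter.eventuallyEq_of_mem (target_mem_nhds hz) fun y hy =>
      UpperHalfPlane.coe_extend_symm he hy
  rw [h.fderiv_eq, fderiv_id]

omit [I.Boundaryless] [ChartedSpace H K] [IsManifold I ∞ K] in
theorem mem_target_prod {z : ℂ × E}
    (hz : z ∈ ((e₁.prod e₂).extend (𝓘(ℝ, ℂ).prod I)).target) :
    z.1 ∈ (e₁.extend 𝓘(ℝ, ℂ)).target ∧ z.2 ∈ (e₂.extend I).target := by
  rw [OpenPartialHomeomorph.extend_prod] at hz
  exact hz

theorem prod_mem_atlas (he₁ : e₁ ∈ atlas ℂ UpperHalfPlane) (he₂ : e₂ ∈ atlas H K) :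
    e₁.prod e₂ ∈ atlas (ModelProd ℂ H) (UpperHalfPlane × K) :=
  ⟨e₁, he₁, e₂, he₂, rfl⟩

theorem chartSymmDeriv_prod (he₁ : e₁ ∈ atlas ℂ UpperHalfPlane) (he₂ : e₂ ∈ atlas H K) {z : ℂ × E}
    (hz : z ∈ ((e₁.prod e₂).extend (𝓘(ℝ, ℂ).prod I)).target) (v : ℂ × E) :
    chartSymmDeriv (𝓘(ℝ, ℂ).prod I) (e₁.prod e₂) z v = (v.1, chartSymmDeriv I e₂ z.2 v.2) := by
  obtain ⟨hz₁, hz₂⟩ := mem_target_prod hz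
  rw [chartSymmDeriv_eq_fderiv (prod_mem_atlas he₁ he₂) hz]
  have h1 := ((contDiffAt_extChartAt_symm he₁ hz₁ (mem_chart_source ℂ _)).differentiableAt
    (by simp)).hasFDerivAt
  have h2 := ((contDiffAt_extChartAt_symm he₂ hz₂ (mem_chart_source H _)).differentiableAt
    (by simp)).hasFDerivAt
  rw [← chartSymmDeriv_eq_fderiv he₁ hz₁, UpperHalfPlane.chartSymmDeriv_eq he₁ hz₁] at h1
  rw [← chartSymmDeriv_eq_fderiv he₂ hz₂] at h2
  have h3 := HasFDerivAt.prodMap z h1 h2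
  have e : extChartAt (𝓘(ℝ, ℂ).prod I) (((e₁.prod e₂).extend (𝓘(ℝ, ℂ).prod I)).symm z) ∘
      ((e₁.prod e₂).extend (𝓘(ℝ, ℂ).prod I)).symm =
      Prod.map (extChartAt 𝓘(ℝ, ℂ) ((e₁.extend 𝓘(ℝ, ℂ)).symm z.1) ∘ (e₁.extend 𝓘(ℝ, ℂ)).symm)
        (extChartAt I ((e₂.extend I).symm z.2) ∘ (e₂.extend I).symm) := by
    rw [OpenPartialHomeomorph.extend_prod]
    simp only [extChartAt_prod]
    rfl
  rw [e, h3.fderiv]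
  rfl

theorem coordMetric_warped (n : ℕ) (S : AlmostHermitianStructure I K)
    (he₁ : e₁ ∈ atlas ℂ UpperHalfPlane) (he₂ : e₂ ∈ atlas H K) {z : ℂ × E}
    (hz : z ∈ ((e₁.prod e₂).extend (𝓘(ℝ, ℂ).prod I)).target) :
    coordMetric (warpedUpperHalfPlane n S).metric (e₁.prod e₂) z =
      halfPlaneWarp (2 / ((n : ℝ) - 1)) (coordMetric S.metric e₂) z := by
  have hz₁ := (mem_target_prod hz).1
  have him : ((e₁.extend 𝓘(ℝ, ℂ)).symm z.1).im = z.1.im :=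
    congrArg Complex.im (UpperHalfPlane.coe_extend_symm he₁ hz₁)
  refine ContinuousLinearMap.ext fun u => ContinuousLinearMap.ext fun v => ?_
  rw [coordMetric_apply, chartSymmDeriv_prod he₁ he₂ hz, chartSymmDeriv_prod he₁ he₂ hz,
    halfPlaneWarp, ← him]
  rfl

theorem coordJ_warped (n : ℕ) (S : AlmostHermitianStructure I K)
    (he₁ : e₁ ∈ atlas ℂ UpperHalfPlane) (he₂ : e₂ ∈ atlas H K) {z : ℂ × E}
    (hz : z ∈ ((e₁.prod e₂).extend (𝓘(ℝ, ℂ).prod I)).target) (v : ℂ × E) :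
    coordJ (warpedUpperHalfPlane n S) (e₁.prod e₂) z v = halfPlaneProdJ (coordJ S e₂) z v := by
  refine chartSymmDeriv_injective (prod_mem_atlas he₁ he₂) hz ?_
  rw [chartSymmDeriv_coordJ _ (prod_mem_atlas he₁ he₂) hz, chartSymmDeriv_prod he₁ he₂ hz,
    chartSymmDeriv_prod he₁ he₂ hz]
  exact Prod.ext rfl (chartSymmDeriv_coordJ S he₂ (mem_target_prod hz).2 v.2).symm

variable [FiniteDimensional ℝ E]
  {F : Type*} [NormedAddCommGroup F] [NormedSpace ℝ F] [FiniteDimensional ℝ F]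
  {H' : Type*} [TopologicalSpace H'] {I' : ModelWithCorners ℝ F H'} [I'.Boundaryless]
  {N : Type*} [TopologicalSpace N] [ChartedSpace H' N] [IsManifold I' ∞ N]
  {e' : OpenPartialHomeomorph N H'}

/-- The passage from manifolds to the coordinate computation. Product charts suffice because the
atlas of `UpperHalfPlane × K` consists of them. -/
theorem isWarpedHolomorphicOn_coord {n : ℕ} {S : AlmostHermitianStructure I K}
    {T : AlmostHermitianStructure I' N} {φ : UpperHalfPlane × K → N}
    (hS : S.IsKahler) (hT : T.IsOneTwoSymplectic)
    (hφ : IsHolomorphicMap (warpedUpperHalfPlane n S) T φ)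
    (he₁ : e₁ ∈ atlas ℂ UpperHalfPlane) (he₂ : e₂ ∈ atlas H K) (he' : e' ∈ atlas H' N) :
    IsWarpedHolomorphicOn (2 / ((n : ℝ) - 1))
      (coordMetric (warpedUpperHalfPlane n S).metric (e₁.prod e₂))
      (coordMetric S.metric e₂) (coordJ S e₂) (e₂.extend I).target
      (coordMetric T.metric e') (coordJ T e') (e'.extend I').target
      (coordMap (𝓘(ℝ, ℂ).prod I) I' φ (e₁.prod e₂) e')
      (coordDomain (𝓘(ℝ, ℂ).prod I) φ (e₁.prod e₂) e') where
  isOpen := isOpen_coordDomain hφ.1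
  source := by
    have := FiniteDimensional.complete ℝ E
    exact isAlmostHermitianOn_coord S he₂
  target := by
    have := FiniteDimensional.complete ℝ F
    exact isAlmostHermitianOn_coord T he'
  source_symplectic y hy := IsOneTwoSymplecticAt.of_closed (hS e₂ he₂ y hy).2
  target_symplectic y hy := hT e' he' y hy
  metric z hz := coordMetric_warped n S he₁ he₂ hz.1
  im_pos z hz := by
    have h := UpperHalfPlane.coe_extend_symm he₁ (mem_target_prod hz.1).1
    rw [← h]
    exact UpperHalfPlane.im_pos _
  snd_mem z hz := (mem_target_prod hz.1).2
  map_mem z hz := (e'.extend I').map_source (by rw [e'.extend_source]; exact hz.2)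
  contDiffOn z hz :=
    (contDiffAt_coordMap hφ.1 (prod_mem_atlas he₁ he₂) he' hz).contDiffWithinAt
  holomorphic z hz v := by
    rw [← coordJ_warped n S he₁ he₂ hz.1]
    exact hφ.fderiv_coordMap (prod_mem_atlas he₁ he₂) he' hz v

omit [FiniteDimensional ℝ E] in
-- The normalisation behind f = 2 / w₂. The bound on `n` reconciles the truncated subtraction in the
-- dimension with the real one in the exponent.
theorem warp_exponent_mul {n : ℕ} (hn : 2 ≤ n) (hd : Module.finrank ℝ E = 2 * (n - 1)) :
    2 / ((n : ℝ) - 1) * Module.finrank ℝ E = 4 := by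
  have h1 : ((n - 1 : ℕ) : ℝ) = (n : ℝ) - 1 := by
    rw [Nat.cast_sub (by omega)]; simp
  have h2 : (2 : ℝ) ≤ n := by exact_mod_cast hn
  have h3 : (n : ℝ) - 1 ≠ 0 := by linarith
  rw [hd]
  push_cast
  rw [h1]
  field_simp
  norm_num

omit [I.Boundaryless] [ChartedSpace H K] [IsManifold I ∞ K] [FiniteDimensional ℝ E]
  [ChartedSpace H' N] in
theorem mem_coordDomain {p : UpperHalfPlane × K} {φ : UpperHalfPlane × K → N}
    (hp : p ∈ (e₁.prod e₂).source) (hp' : φ p ∈ e'.source) :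
    (e₁.prod e₂).extend (𝓘(ℝ, ℂ).prod I) p ∈ coordDomain (𝓘(ℝ, ℂ).prod I) φ (e₁.prod e₂) e' := by
  have h : p ∈ ((e₁.prod e₂).extend (𝓘(ℝ, ℂ).prod I)).source := by
    rwa [OpenPartialHomeomorph.extend_source]
  refine ⟨PartialEquiv.map_source _ h, ?_⟩
  rw [Set.mem_ofPred_eq, PartialEquiv.left_inv _ h]
  exact hp'

/-- Holomorphic maps from the warped product of the upper half plane with a Kähler manifold into
`(1,2)`-symplectic manifolds are biharmonic. -/
theorem IsHolomorphicMap.isBiharmonicMap {n : ℕ} (hn : 2 ≤ n) {S : AlmostHermitianStructure I K}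
    {T : AlmostHermitianStructure I' N} {φ : UpperHalfPlane × K → N}
    (hd : Module.finrank ℝ E = 2 * (n - 1)) (hS : S.IsKahler) (hT : T.IsOneTwoSymplectic)
    (hφ : IsHolomorphicMap (warpedUpperHalfPlane n S) T φ) :
    IsBiharmonicMap (warpedUpperHalfPlane n S).metric T.metric φ := by
  refine ⟨hφ.1, ?_⟩
  rintro _ ⟨e₁, he₁, e₂, he₂, rfl⟩ e' he' p hp hp'
  exact (isWarpedHolomorphicOn_coord hS hT hφ he₁ he₂ he').bitension_eq_zero
    (mem_coordDomain hp hp') (warp_exponent_mul hn hd)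

end WarpedCharts

/-! ### Flat structures and the projection to the upper half plane -/

section Flat

variable {V : Type*} [NormedAddCommGroup V] [InnerProductSpace ℝ V]

theorem tangentCoordChange_self_model (x y z : V) :
    tangentCoordChange 𝓘(ℝ, V) x y z = ContinuousLinearMap.id ℝ V :=
  ContinuousLinearMap.ext fun v =>
    tangentCoordChange_self (I := 𝓘(ℝ, V)) (x := z) (z := z) (v := v) (by simp)

/-- The flat almost Hermitian structure on an inner product space given by an orthogonal complex
structure. -/
def flatStructure (J : V →L[ℝ] V) (hJ : ∀ v, J (J v) = -v)
    (hinner : ∀ v w : V, inner ℝ (J v) (J w) = inner ℝ v w) :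
    AlmostHermitianStructure 𝓘(ℝ, V) V where
  metric :=
    { inner := fun _ => (innerSL ℝ : V →L[ℝ] V →L[ℝ] ℝ)
      symm := fun _ v w => real_inner_comm (F := V) w v
      pos := fun _ v hv => real_inner_self_pos (F := V).2 hv
      isVonNBounded := fun x => (riemannianMetricVectorSpace V).isVonNBounded x
      contMDiff := fun x => by
        refine (contMDiffAt_bilin_iff (I := 𝓘(ℝ, V)) (M := V)
          (fun _ => (innerSL ℝ : V →L[ℝ] V →L[ℝ] ℝ)) x).2 ?_
        simp only [tangentCoordChange_self_model]
        exact contMDiffAt_const }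
  J _ := J
  contMDiff_J x := by
    refine (contMDiffAt_endo_iff (I := 𝓘(ℝ, V)) (M := V) (fun _ => J) x).2 ?_
    simp only [tangentCoordChange_self_model]
    exact contMDiffAt_const (c := J)
  J_J _ := hJ
  inner_J_J _ := hinner

theorem chartSymmDeriv_model {e : OpenPartialHomeomorph V V} (he : e ∈ atlas V V) (x : V) :
    chartSymmDeriv 𝓘(ℝ, V) e x = ContinuousLinearMap.id ℝ V := by
  obtain rfl : e = OpenPartialHomeomorph.refl V := by simpa using he
  exact mfderiv_id

theorem chartDeriv_model {e : OpenPartialHomeomorph V V} (he : e ∈ atlas V V) (x : V) :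
    chartDeriv 𝓘(ℝ, V) e x = ContinuousLinearMap.id ℝ V := by
  obtain rfl : e = OpenPartialHomeomorph.refl V := by simpa using he
  exact mfderiv_id

variable {J : V →L[ℝ] V} {hJ : ∀ v, J (J v) = -v}
    {hinner : ∀ v w : V, inner ℝ (J v) (J w) = inner ℝ v w}
    {e : OpenPartialHomeomorph V V}

theorem coordMetric_flatStructure (he : e ∈ atlas V V) :
    coordMetric (flatStructure J hJ hinner).metric e =
      fun _ => (innerSL ℝ : V →L[ℝ] V →L[ℝ] ℝ) := by
  refine funext fun x => ContinuousLinearMap.ext fun u => ContinuousLinearMap.ext fun v => ?_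
  rw [coordMetric_apply, chartSymmDeriv_model he]
  rfl

theorem coordJ_flatStructure (he : e ∈ atlas V V) :
    coordJ (flatStructure J hJ hinner) e = fun _ => J := by
  refine funext fun x => ContinuousLinearMap.ext fun v => ?_
  have h : x ∈ (e.extend 𝓘(ℝ, V)).target := by
    obtain rfl : e = OpenPartialHomeomorph.refl V := by simpa using he
    simp
  have h1 := chartSymmDeriv_coordJ (flatStructure J hJ hinner) he h v
  rw [chartSymmDeriv_model he] at h1
  exact h1

theorem isKahler_flatStructure : (flatStructure J hJ hinner).IsKahler := by
  intro e he x _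
  rw [coordMetric_flatStructure he, coordJ_flatStructure he]
  have h : ∀ u v : V, VectorField.lieBracket ℝ (fun _ => u) (fun _ => v) x = 0 := fun u v => by
    simp [VectorField.lieBracket]
  refine ⟨fun u v => ?_, fun u v w => ?_⟩
  · simp [nijenhuis, h]
  · simp [dFundamentalForm, fundamentalForm]

theorem AlmostHermitianStructure.IsKahler.isOneTwoSymplectic {E : Type*} [NormedAddCommGroup E]
    [NormedSpace ℝ E] {H : Type*} [TopologicalSpace H] {I : ModelWithCorners ℝ E H} {M : Type*}
    [TopologicalSpace M] [ChartedSpace H M] [IsManifold I ∞ M] {S : AlmostHermitianStructure I M}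
    (hS : S.IsKahler) : S.IsOneTwoSymplectic :=
  fun e he x hx => IsOneTwoSymplecticAt.of_closed (hS e he x hx).2

end Flat

/-! ### The projection to the half plane: holomorphic, not harmonic -/

section Projection

theorem contMDiff_coe_real : ContMDiff 𝓘(ℝ, ℂ) 𝓘(ℝ, ℂ) ∞ (UpperHalfPlane.coe) :=
  fun _ => contMDiffAt_extChartAt

/-- The inclusion is itself the chart, and the inverse chart has derivative the identity. -/
theorem mfderiv_coe_real (w : UpperHalfPlane) (v : ℂ) :
    (mfderiv 𝓘(ℝ, ℂ) 𝓘(ℝ, ℂ) UpperHalfPlane.coe w : ℂ →L[ℝ] ℂ) v = v := by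
  have he := chart_mem_atlas ℂ w
  have hx : (w : ℂ) ∈ ((chartAt ℂ w).extend 𝓘(ℝ, ℂ)).target :=
    mem_extChartAt_target (I := 𝓘(ℝ, ℂ)) w
  have h1 := chartDeriv_chartSymmDeriv he hx v
  rw [UpperHalfPlane.chartSymmDeriv_eq he hx] at h1
  have h2 : ((chartAt ℂ w).extend 𝓘(ℝ, ℂ)).symm (w : ℂ) = w :=
    extChartAt_to_inv (I := 𝓘(ℝ, ℂ)) w
  rw [h2] at h1
  exact h1

variable {E : Type*} [NormedAddCommGroup E] [NormedSpace ℝ E]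
  {H : Type*} [TopologicalSpace H] {I : ModelWithCorners ℝ E H}
  {K : Type*} [TopologicalSpace K] [ChartedSpace H K]

/-- The projection to the upper half plane, as a map to `ℂ`. -/
def halfPlaneProj (K : Type*) (p : UpperHalfPlane × K) : ℂ := p.1

theorem contMDiff_halfPlaneProj : ContMDiff (𝓘(ℝ, ℂ).prod I) 𝓘(ℝ, ℂ) ∞ (halfPlaneProj K) :=
  contMDiff_coe_real.comp contMDiff_fst

theorem mfderiv_halfPlaneProj (p : UpperHalfPlane × K) (v : ℂ × E) :
    (mfderiv (𝓘(ℝ, ℂ).prod I) 𝓘(ℝ, ℂ) (halfPlaneProj K) p : ℂ × E →L[ℝ] ℂ) v = v.1 := by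
  have h := mfderiv_comp (I := 𝓘(ℝ, ℂ).prod I) (I' := 𝓘(ℝ, ℂ)) (I'' := 𝓘(ℝ, ℂ))
    (g := UpperHalfPlane.coe) (f := Prod.fst) p
    ((contMDiff_coe_real p.1).mdifferentiableAt (by simp)) mdifferentiableAt_fst
  rw [mfderiv_fst] at h
  refine (congrArg (fun A : ℂ × E →L[ℝ] ℂ => A v) h).trans ?_
  exact mfderiv_coe_real p.1 v.1

theorem isHolomorphicMap_halfPlaneProj [IsManifold I ∞ K] (n : ℕ) (S : AlmostHermitianStructure I K)
    {hJ : ∀ v, (Complex.I • ContinuousLinearMap.id ℝ ℂ : ℂ →L[ℝ] ℂ)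
      ((Complex.I • ContinuousLinearMap.id ℝ ℂ : ℂ →L[ℝ] ℂ) v) = -v}
    {hinner : ∀ v w : ℂ, inner ℝ ((Complex.I • ContinuousLinearMap.id ℝ ℂ : ℂ →L[ℝ] ℂ) v)
      ((Complex.I • ContinuousLinearMap.id ℝ ℂ : ℂ →L[ℝ] ℂ) w) = inner ℝ v w} :
    IsHolomorphicMap (warpedUpperHalfPlane n S)
      (flatStructure (Complex.I • ContinuousLinearMap.id ℝ ℂ : ℂ →L[ℝ] ℂ) hJ hinner)
      (halfPlaneProj K) := by
  refine ⟨contMDiff_halfPlaneProj, fun p v => ?_⟩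
  refine (mfderiv_halfPlaneProj (I := I) p _).trans ?_
  exact congrArg (fun w : ℂ => Complex.I • w) (mfderiv_halfPlaneProj (I := I) p v).symm

/-- By `tension_eq` the tension field is (2 / w₂) i. It is nonzero everywhere, so the choice of the
point over i is immaterial. -/
theorem not_isHarmonicMap_halfPlaneProj [FiniteDimensional ℝ E] [I.Boundaryless]
    [IsManifold I ∞ K] [Nonempty K] {n : ℕ} (hn : 2 ≤ n)
    (hd : Module.finrank ℝ E = 2 * (n - 1)) {S : AlmostHermitianStructure I K} (hS : S.IsKahler)
    {T : AlmostHermitianStructure 𝓘(ℝ, ℂ) ℂ} (hT : T.IsOneTwoSymplectic)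
    (hφ : IsHolomorphicMap (warpedUpperHalfPlane n S) T (halfPlaneProj K)) :
    ¬ IsHarmonicMap (warpedUpperHalfPlane n S).metric T.metric (halfPlaneProj K) := by
  rintro ⟨-, h⟩
  obtain ⟨y⟩ := ‹Nonempty K›
  set p : UpperHalfPlane × K := (UpperHalfPlane.I, y)
  obtain ⟨e₁, he₁, hp₁⟩ : ∃ e₁ ∈ atlas ℂ UpperHalfPlane, p.1 ∈ e₁.source :=
    ⟨_, chart_mem_atlas ℂ p.1, mem_chart_source ℂ p.1⟩
  obtain ⟨e₂, he₂, hp₂⟩ : ∃ e₂ ∈ atlas H K, p.2 ∈ e₂.source :=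
    ⟨_, chart_mem_atlas H p.2, mem_chart_source H p.2⟩
  have he' := chart_mem_atlas ℂ (halfPlaneProj K p)
  have hp : p ∈ (e₁.prod e₂).source := ⟨hp₁, hp₂⟩
  have hp' : halfPlaneProj K p ∈ (chartAt ℂ (halfPlaneProj K p)).source := mem_chart_source ℂ _
  have h1 := h _ (prod_mem_atlas he₁ he₂) _ he' p hp hp'
  have hx := mem_coordDomain (I := I) hp hp'
  have hW := isWarpedHolomorphicOn_coord hS hT hφ he₁ he₂ he'
  rw [hW.tension_eq hx (warp_exponent_mul hn hd),
    fderiv_coordMap hφ.1 (prod_mem_atlas he₁ he₂) he' hx, chartDeriv_model he',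
    chartSymmDeriv_prod he₁ he₂ hx.1] at h1
  set x := (e₁.prod e₂).extend (𝓘(ℝ, ℂ).prod I) p
  have h2 := mfderiv_halfPlaneProj (I := I) (((e₁.prod e₂).extend (𝓘(ℝ, ℂ).prod I)).symm x)
    (Complex.I, chartSymmDeriv I e₂ x.2 0)
  have h3 := (congrArg (fun w : ℂ => (2 / x.1.im) • w) h2).symm.trans h1
  rcases smul_eq_zero.1 h3 with h4 | h4
  · exact (div_pos two_pos (hW.im_pos _ hx)).ne' h4
  · exact Complex.I_ne_zero h4

end Projection

/-! ### The flat Kähler structure on complex Euclidean space -/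

section Euclidean

variable (m : ℕ)

/-- Multiplication by `i` on `ℂᵐ`. -/
def mulI : EuclideanSpace ℂ (Fin m) →L[ℝ] EuclideanSpace ℂ (Fin m) :=
  ContinuousLinearMap.restrictScalars ℝ (Complex.I • ContinuousLinearMap.id ℂ
    (EuclideanSpace ℂ (Fin m)))

theorem mulI_mulI (v : EuclideanSpace ℂ (Fin m)) : mulI m (mulI m v) = -v := by
  simp [mulI, smul_smul]

theorem inner_mulI (v w : EuclideanSpace ℂ (Fin m)) :
    inner ℝ (mulI m v) (mulI m w) = inner ℝ v w := by
  simp [mulI, PiLp.inner_apply, Complex.inner]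

/-- The flat Kähler structure on `ℂᵐ`. -/
def flatEuclidean : AlmostHermitianStructure 𝓘(ℝ, EuclideanSpace ℂ (Fin m))
    (EuclideanSpace ℂ (Fin m)) :=
  flatStructure (mulI m) (mulI_mulI m) (inner_mulI m)

theorem finrank_real_euclidean : Module.finrank ℝ (EuclideanSpace ℂ (Fin m)) = 2 * m := by
  rw [finrank_real_of_complex, finrank_euclideanSpace_fin]

end Euclidean

end

theorem mainTheorem9 (n : ℕ) (hn : 2 ≤ n) :
    (∀ {E : Type*} [NormedAddCommGroup E] [NormedSpace ℝ E] [FiniteDimensional ℝ E]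
      {H : Type*} [TopologicalSpace H] {I : ModelWithCorners ℝ E H} [I.Boundaryless]
      {K : Type*} [TopologicalSpace K] [ChartedSpace H K] [IsManifold I ∞ K]
      {F : Type*} [NormedAddCommGroup F] [NormedSpace ℝ F] [FiniteDimensional ℝ F]
      {H' : Type*} [TopologicalSpace H'] {I' : ModelWithCorners ℝ F H'} [I'.Boundaryless]
      {N : Type*} [TopologicalSpace N] [ChartedSpace H' N] [IsManifold I' ∞ N]
      (S : AlmostHermitianStructure I K) (T : AlmostHermitianStructure I' N)
      (φ : UpperHalfPlane × K → N),
      Module.finrank ℝ E = 2 * (n - 1) → S.IsKahler → T.IsOneTwoSymplectic →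
      IsHolomorphicMap (warpedUpperHalfPlane n S) T φ →
      IsBiharmonicMap (warpedUpperHalfPlane n S).metric T.metric φ) ∧
    (∃ (S : AlmostHermitianStructure 𝓘(ℝ, EuclideanSpace ℂ (Fin (n - 1)))
        (EuclideanSpace ℂ (Fin (n - 1))))
      (T : AlmostHermitianStructure 𝓘(ℝ, ℂ) ℂ)
      (φ : UpperHalfPlane × EuclideanSpace ℂ (Fin (n - 1)) → ℂ),
      S.IsKahler ∧ T.IsOneTwoSymplectic ∧ IsHolomorphicMap (warpedUpperHalfPlane n S) T φ ∧
      IsBiharmonicMap (warpedUpperHalfPlane n S).metric T.metric φ ∧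
      ¬ IsHarmonicMap (warpedUpperHalfPlane n S).metric T.metric φ) := by
  refine ⟨fun S T φ hd hS hT hφ => hφ.isBiharmonicMap hn hd hS hT, ?_⟩
  have hd := finrank_real_euclidean (n - 1)
  have hS : (flatEuclidean (n - 1)).IsKahler := isKahler_flatStructure
  have hT : (flatStructure (Complex.I • ContinuousLinearMap.id ℝ ℂ : ℂ →L[ℝ] ℂ) I_smul_I_smul
    inner_I_smul).IsOneTwoSymplectic := isKahler_flatStructure.isOneTwoSymplectic
  have hφ := isHolomorphicMap_halfPlaneProj n (flatEuclidean (n - 1))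
    (hJ := I_smul_I_smul) (hinner := inner_I_smul)
  -- The example is the projection (w, x) ↦ w from the warped product with flat ℂⁿ⁻¹ to flat ℂ; its
  -- biharmonicity is an instance of the first claim.
  exact ⟨_, _, _, hS, hT, hφ, hφ.isBiharmonicMap hn hd hS hT,
    not_isHarmonicMap_halfPlaneProj hn hd hS hT hφ⟩
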